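/- Let $d\ge 1$ and let $p_\theta(x)=h(x)\exp(\langle\theta,s(x)\rangle-A(\theta))$, $\theta\in\Theta\subset\mathbb R^d$, be a minimal regular exponential family (densities with respect to a fixed measure) with $\|s(x)\|_2\le B$ for all $x$, where $B>0$. Here $\Theta$ is a subset of the natural parameter space, $\theta_0$ lies in the interior of $\Theta$, and the Fisher information $I=I(\theta_0)$ of one observation is positive definite. Let $\varepsilon_n>0$ and $\delta_n\in(0,1)$ (for all large $n$), and let $\sigma_n$ be the smallest $\sigma$ such that adding $N(0,\sigma^2 I_d)$ noise to any $\mathbb R^d$-valued query of $\ell_2$-sensitivity at most $2B/n$ is $(\varepsilon_n,\delta_n)$-differentially private. Let $X_1,X_2,\dots$ be i.i.d. from $p_{\theta_0}$, let $\bar S_n=\frac1n\sum_{i\le n}s(X_i)$, and let $\widetilde S_n=\bar S_n+Z_n$ with $Z_n\sim N(0,\sigma_n^2I_d)$ independent of $X_1,\dots,X_n$. Let $\hat\theta_n$ be the (non-private) maximum likelihood estimator over $\Theta$ and let $\widetilde\theta_n$ be the plug-in DP MLE, the solution $\theta\in\Theta$ of $\nabla A(\theta)=\widetilde S_n$; both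 are arbitrary (measurable) where they do not exist. Call such an estimator $T_n$ asymptotically efficient (along a sequence of sample sizes) if it exists with probability tending to $1$ and $\sqrt n(T_n-\theta_0)\to N(0,I^{-1})$ in distribution. (a) If $n\varepsilon_n^2/\log(1/\delta_n)\to\infty$, then the privacy variance term $n\sigma_n^2I^{-2}$ tends to $0$, and both the MLE $\hat\theta_n$ and the plug-in DP MLE $\widetilde\theta_n$ are asymptotically efficient, with the same limit law $N(0,I^{-1})$. (b) If $n\varepsilon_n^2$ is bounded and $\delta_n=O(n^{-1/2})$, then the DP noise causes a non-negligible variance inflation. Precisely, there is $c>0$ such that $I^{-1}+n\sigma_n^2I^{-2}\succeq I^{-1}+c\,I^{-2}$ for all large $n$. If moreover $\sigma_n\to0$, then $\widetilde\theta_n$ exists with probability tending to $1$ and $(I^{-1}+n\sigma_n^2I^{-2})^{-1/2}\sqrt n(\widetilde\theta_n-\theta_0)\to N(0,I_d)$ in distribution. In every case, $\widetilde\theta_n$ is not asymptotically efficient along any subsequence of sample sizes. -/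

import Mathlib

open MeasureTheory ProbabilityTheory Filter Topology
open scoped RealInnerProductSpace MatrixOrder

noncomputable section

/-! ### Differential privacy and the calibrated Gaussian mechanism -/

/-- Two datasets of the same size are neighbors if they differ in (at most) a single record. -/
def Neighbors {𝒴 : Type*} {m : ℕ} (D D' : Fin m → 𝒴) : Prop :=
  ∃ i, ∀ j, j ≠ i → D j = D' j

/-- A randomized mechanism, given by the law `M D` of its output on the dataset `D`,
is `(ε, δ)`-differentially private. -/
def IsDP {𝒴 F : Type*} [MeasurableSpace F] {m : ℕ} (M : (Fin m → 𝒴) → Measure F)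
    (ε δ : ℝ) : Prop :=
  ∀ D D', Neighbors D D' → ∀ S, MeasurableSet S →
    M D S ≤ ENNReal.ofReal (Real.exp ε) * M D' S + ENNReal.ofReal δ

/-- The query `q` has `ℓ²`-sensitivity at most `Δ`. -/
def HasSensitivityLE {𝒴 : Type*} {m d : ℕ} (q : (Fin m → 𝒴) → EuclideanSpace ℝ (Fin d))
    (Δ : ℝ) : Prop :=
  ∀ D D', Neighbors D D' → ‖q D - q D'‖ ≤ Δ

/-- The isotropic Gaussian law `N(v, σ² I_d)`. -/
def isoGaussian {d : ℕ} (v : EuclideanSpace ℝ (Fin d)) (σ : ℝ) :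
    Measure (EuclideanSpace ℝ (Fin d)) :=
  multivariateGaussian v (σ ^ 2 • (1 : Matrix (Fin d) (Fin d) ℝ))

/-- Analytic Gaussian calibration: the smallest `σ` such that adding `N(0, σ² I_d)` noise to any
query with values in `ℝ^d` and `ℓ²`-sensitivity at most `Δ` is `(ε, δ)`-DP. -/
def agm (d : ℕ) (Δ ε δ : ℝ) : ℝ :=
  sInf {σ : ℝ | 0 < σ ∧ ∀ (𝒴 : Type) (m : ℕ) (q : (Fin m → 𝒴) → EuclideanSpace ℝ (Fin d)),
    HasSensitivityLE q Δ → IsDP (fun D => isoGaussian (q D) σ) ε δ}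

/-! ### Exponential families -/

/-- The data of an exponential family on `𝒳` with `d`-dimensional sufficient statistic:
dominating measure, carrier function `h` and sufficient statistic `s`. -/
structure ExpFamily (𝒳 : Type*) [MeasurableSpace 𝒳] (d : ℕ) where
  base : Measure 𝒳
  h : 𝒳 → ℝ
  h_nonneg : ∀ x, 0 ≤ h x
  measurable_h : Measurable h
  s : 𝒳 → EuclideanSpace ℝ (Fin d)
  measurable_s : Measurable s

namespace ExpFamily

variable {𝒳 : Type*} [MeasurableSpace 𝒳] {d : ℕ} (M : ExpFamily 𝒳 d)

/-- The natural parameter space. -/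
def naturalSpace : Set (EuclideanSpace ℝ (Fin d)) :=
  {θ | Integrable (fun x => M.h x * Real.exp ⟪θ, M.s x⟫) M.base}

/-- The log-partition function `A`. -/
def logPartition (θ : EuclideanSpace ℝ (Fin d)) : ℝ :=
  Real.log (∫ x, M.h x * Real.exp ⟪θ, M.s x⟫ ∂M.base)

/-- The density `p_θ(x) = h(x) exp(⟨θ, s(x)⟩ - A(θ))` with respect to the dominating measure. -/
def density (θ : EuclideanSpace ℝ (Fin d)) (x : 𝒳) : ℝ :=
  M.h x * Real.exp (⟪θ, M.s x⟫ - M.logPartition θ)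

/-- The law `P_θ` of one observation. -/
def law (θ : EuclideanSpace ℝ (Fin d)) : Measure 𝒳 :=
  M.base.withDensity (fun x => ENNReal.ofReal (M.density θ x))

/-- A minimal regular exponential family: the natural parameter space is open and the components
of the sufficient statistic satisfy no nontrivial affine relation almost everywhere. -/
structure IsMinimalRegular : Prop where
  isOpen_naturalSpace : IsOpen M.naturalSpace
  minimal : ∀ (u : EuclideanSpace ℝ (Fin d)) (c : ℝ),
    (∀ᵐ x ∂(M.base.withDensity fun x => ENNReal.ofReal (M.h x)), ⟪u, M.s x⟫ = c) → u = 0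

/-- The mean-parameter map `∇A`. -/
def meanMap (θ : EuclideanSpace ℝ (Fin d)) : EuclideanSpace ℝ (Fin d) :=
  gradient M.logPartition θ

/-- The score `∇_θ log p_θ(x)` of one observation. -/
def score (θ : EuclideanSpace ℝ (Fin d)) (x : 𝒳) : EuclideanSpace ℝ (Fin d) :=
  gradient (fun t => Real.log (M.density t x)) θ

/-- The Fisher information matrix of one observation. -/
def fisher (θ : EuclideanSpace ℝ (Fin d)) : Matrix (Fin d) (Fin d) ℝ :=
  Matrix.of fun i j => ∫ x, M.score θ x i * M.score θ x j ∂(M.law θ)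

/-- The empirical sufficient statistic of a dataset. -/
def empStat {n : ℕ} (D : Fin n → 𝒳) : EuclideanSpace ℝ (Fin d) :=
  (n : ℝ)⁻¹ • ∑ i, M.s (D i)

/-- The maximum likelihood estimates over `Θ` for a dataset
(the empty set when no maximizer exists). -/
def mleSet (Θ : Set (EuclideanSpace ℝ (Fin d))) {n : ℕ} (D : Fin n → 𝒳) :
    Set (EuclideanSpace ℝ (Fin d)) :=
  {θ | θ ∈ Θ ∧ IsMaxOn (fun t => ∏ i, M.density t (D i)) Θ θ}

/-- The plug-in estimates over `Θ` for a (noisy) value `y` of the sufficient statistic: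
the solutions `θ ∈ Θ` of `∇A(θ) = y`. -/
def plugInSet (Θ : Set (EuclideanSpace ℝ (Fin d))) (y : EuclideanSpace ℝ (Fin d)) :
    Set (EuclideanSpace ℝ (Fin d)) :=
  {θ | θ ∈ Θ ∧ M.meanMap θ = y}

/-- The covariance matrix `I(θ)⁻¹ + v I(θ)⁻²`; with `v = n σ²` it is the covariance of
`√n (θ̃ - θ)` predicted for the plug-in estimator with noise level `σ`. -/
def inflatedCov (θ : EuclideanSpace ℝ (Fin d)) (v : ℝ) : Matrix (Fin d) (Fin d) ℝ :=
  (M.fisher θ)⁻¹ + v • ((M.fisher θ)⁻¹ * (M.fisher θ)⁻¹)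

/-- Asymptotic efficiency at `θ₀`, along a filter `l` of sample sizes, of the estimators `T n`
defined by the estimating problems with solution sets `sol n ω`: a solution exists with probability
tending to one, and `√n (T n - θ₀)` converges in distribution to `N(0, I(θ₀)⁻¹)`. -/
def AsymptoticallyEfficient (θ₀ : EuclideanSpace ℝ (Fin d)) {Ω : Type*} [MeasurableSpace Ω]
    (P : Measure Ω) [IsProbabilityMeasure P] (sol : ℕ → Ω → Set (EuclideanSpace ℝ (Fin d)))
    (T : ℕ → Ω → EuclideanSpace ℝ (Fin d)) (l : Filter ℕ) : Prop :=
  Tendsto (fun n => P {ω | (sol n ω).Nonempty}) l (𝓝 1) ∧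
  TendstoInDistribution (fun (n : ℕ) ω => √(n : ℝ) • (T n ω - θ₀)) l id (fun _ => P)
    (multivariateGaussian 0 (M.fisher θ₀)⁻¹)

end ExpFamily

end

/-! With probability tending to 1 both estimators are one and the same smooth function of a sample
mean. Boundedness of `s` makes `A` smooth with Hessian `Cov(s) = I`; minimality makes `A` strictly
convex, so `∇A` is injective. Near `m = ∇A(θ₀)` it has a local inverse `ψ` with values in `Θ` and
derivative `I⁻¹` at `m` (`exists_localInverse`). As soon as the statistic is close to `m`, the
plug-in estimate is exactly `ψ(S̃)` and, almost surely, the MLE is exactly `ψ(S̄)`. Limit laws then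
follow from the delta method applied to `√n (S̃ - m)`. The characteristic function of that vector is
within `O(n^(-1/2))` of `exp(-(⟪t, I t⟫ + n σ² ‖t‖²) / 2)`, with an error that does not involve `σ`
(`norm_charFun_noisyStat_sub_le`). Everything therefore depends on the size of `n σ²`.

Upper bound on `σ`: a Chernoff bound for the log-likelihood ratio of two shifted Gaussians gives `σ²
≤ Δ² (1/ε + 8 log(1/δ)/ε²)` with `Δ = 2B/n` (`sq_agm_le`), and `n σ² → 0` in (a). Lower bound: a
half-space test separates two outputs at distance `Δ`, which forces `Δ/σ = O(e^ε - 1 + δ)`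
(`le_agm`). In (b) this is `O(n^(-1/2))`, so `n σ²` stays above some `c > 0`.

In (b) `n σ²` may be unbounded and need not converge, so the standardized limit uses a delta method
with varying normalizing matrices. It works because the predicted covariance has all its eigenvalues
of order `1 + n σ²`, uniformly in `n`.

Inefficiency is the delta method run backwards: if `θ̃` were efficient along a subsequence, then `S̃
= ∇A(θ̃)` would satisfy `√n (S̃ - m) → N(0, I)`, contradicting the extra factor `exp(-c ‖t‖² / 2)`
in its characteristic function. This does not need `σ → 0`. -/

open MeasureTheory ProbabilityTheory Filter Topology
open scoped RealInnerProductSpace MatrixOrder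

noncomputable section

/-! ### Projections, exponential moments and tilting of isotropic Gaussian laws -/

section IsoGaussian

variable {d : ℕ}

instance (a : EuclideanSpace ℝ (Fin d)) (σ : ℝ) : IsGaussian (isoGaussian a σ) := by
  unfold isoGaussian; infer_instance

theorem posSemidef_sq_smul_one (σ : ℝ) :
    (σ ^ 2 • (1 : Matrix (Fin d) (Fin d) ℝ)).PosSemidef :=
  Matrix.PosSemidef.one.smul (sq_nonneg σ)

theorem isoGaussian_map_inner (a : EuclideanSpace ℝ (Fin d)) (σ : ℝ)
    (t : EuclideanSpace ℝ (Fin d)) :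
    (isoGaussian a σ).map (fun x => ⟪t, x⟫) = gaussianReal ⟪t, a⟫ (σ ^ 2 * ‖t‖ ^ 2).toNNReal := by
  have h := IsGaussian.map_eq_gaussianReal (μ := isoGaussian a σ) (innerSL ℝ t)
  have h1 : (∫ x, (innerSL ℝ t) x ∂(isoGaussian a σ)) = ⟪t, a⟫ := by
    rw [ContinuousLinearMap.integral_comp_id_comm IsGaussian.integrable_id]
    simp [isoGaussian]
  have h2 : Var[(innerSL ℝ t); isoGaussian a σ] = σ ^ 2 * ‖t‖ ^ 2 := by
    have := covarianceBilin_self (μ := isoGaussian a σ) IsGaussian.memLp_two_id t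
    rw [isoGaussian, covarianceBilin_multivariateGaussian (posSemidef_sq_smul_one σ)] at this
    rw [isoGaussian]
    refine Eq.trans this.symm ?_
    simp [Matrix.smul_mulVec, EuclideanSpace.real_norm_sq_eq, dotProduct, Finset.mul_sum]
    exact Finset.sum_congr rfl fun i _ => by ring
  rw [h1, h2] at h
  exact h

theorem integral_exp_inner_isoGaussian (b : EuclideanSpace ℝ (Fin d)) (σ : ℝ)
    (u : EuclideanSpace ℝ (Fin d)) :
    ∫ x, Real.exp ⟪u, x⟫ ∂(isoGaussian b σ) = Real.exp (⟪u, b⟫ + σ ^ 2 * ‖u‖ ^ 2 / 2) := by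
  have := mgf_gaussianReal (isoGaussian_map_inner b σ u) 1
  simpa [mgf, Real.coe_toNNReal _ (by positivity : 0 ≤ σ ^ 2 * ‖u‖ ^ 2)] using this

theorem integrable_exp_inner_isoGaussian (b : EuclideanSpace ℝ (Fin d)) (σ : ℝ)
    (u : EuclideanSpace ℝ (Fin d)) :
    Integrable (fun x => Real.exp ⟪u, x⟫) (isoGaussian b σ) := by
  -- The Bochner integral of a non-integrable function is 0, but the computed value is a positive
  -- exponential.
  by_contra h
  have := integral_exp_inner_isoGaussian b σ u
  rw [integral_undef h] at this
  exact (Real.exp_pos _).ne this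

/-- This supplies the likelihood ratio of two shifted Gaussians without Lebesgue densities. The
moment generating functions of all projections agree and are finite everywhere, so by analytic
continuation they agree at `Complex.I`, where they are characteristic functions. -/
theorem isoGaussian_tilted (b v : EuclideanSpace ℝ (Fin d)) (σ : ℝ) :
    (isoGaussian b σ).tilted (fun x => ⟪v, x⟫) = isoGaussian (b + σ ^ 2 • v) σ := by
  have : IsProbabilityMeasure ((isoGaussian b σ).tilted (fun x => ⟪v, x⟫)) :=
    isProbabilityMeasure_tilted (integrable_exp_inner_isoGaussian b σ v)
  apply Measure.ext_of_charFun
  ext t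
  have hmgf : mgf (fun x => ⟪t, x⟫) (isoGaussian (b + σ ^ 2 • v) σ) =
      mgf (fun x => ⟪t, x⟫) ((isoGaussian b σ).tilted (fun x => ⟪v, x⟫)) := by
    ext r
    rw [mgf_gaussianReal (isoGaussian_map_inner _ σ t), mgf, integral_tilted]
    simp_rw [integral_exp_inner_isoGaussian, smul_eq_mul, div_mul_eq_mul_div]
    rw [integral_div]
    have h2 : ∀ x : EuclideanSpace ℝ (Fin d),
        Real.exp ⟪v, x⟫ * Real.exp (r * ⟪t, x⟫) = Real.exp ⟪v + r • t, x⟫ := fun x => by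
      rw [← Real.exp_add, inner_add_left, real_inner_smul_left]
    simp_rw [h2, integral_exp_inner_isoGaussian]
    rw [← Real.exp_sub, Real.coe_toNNReal _ (by positivity), norm_add_sq_real,
      inner_add_right, inner_add_left, real_inner_smul_left, real_inner_smul_right,
      real_inner_smul_right, norm_smul, mul_pow, Real.norm_eq_abs, sq_abs,
      real_inner_comm t v]
    congr 1
    ring
  have hset : integrableExpSet (fun x => ⟪t, x⟫) (isoGaussian (b + σ ^ 2 • v) σ) = Set.univ := by
    refine Set.eq_univ_of_forall fun r => ?_
    have := integrable_exp_inner_isoGaussian (b + σ ^ 2 • v) σ (r • t)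
    simpa [integrableExpSet, real_inner_smul_left] using this
  have := eqOn_complexMGF_of_mgf hmgf (x := Complex.I) (by simp [hset])
  simp only [complexMGF] at this
  simp only [charFun_apply]
  rw [← sub_eq_zero] at this ⊢
  rw [← neg_eq_zero, neg_sub, ← this]
  congr 1 <;>
  · refine integral_congr_ae (ae_of_all _ fun x => ?_)
    simp only
    rw [real_inner_comm, mul_comm]

end IsoGaussian

/-! ### Privacy of the Gaussian mechanism -/

section GaussianMechanism

variable {d : ℕ}

/-- Chernoff's method: with `L` the log-likelihood ratio of the two laws, `e^L ≤ e^ε + e^((l+1)L -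
lε)` for every `l ≥ 0`. The first term pays the factor `e^ε`; the second has an explicit Gaussian
integral, to be made at most `δ`. -/
theorem isoGaussian_apply_le {a b : EuclideanSpace ℝ (Fin d)} {σ ε δ : ℝ} (hσ : 0 < σ)
    (hε : 0 < ε) (hδ : 0 < δ) (h1 : ‖a - b‖ ^ 2 ≤ ε * σ ^ 2)
    (h2 : 8 * Real.log (1 / δ) * ‖a - b‖ ^ 2 ≤ ε ^ 2 * σ ^ 2)
    {S : Set (EuclideanSpace ℝ (Fin d))} (hS : MeasurableSet S) :
    isoGaussian a σ S ≤ ENNReal.ofReal (Real.exp ε) * isoGaussian b σ S + ENNReal.ofReal δ := by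
  rcases eq_or_ne a b with rfl | hab
  · have : (1 : ENNReal) ≤ ENNReal.ofReal (Real.exp ε) :=
      ENNReal.one_le_ofReal.2 (Real.one_le_exp hε.le)
    calc isoGaussian a σ S = 1 * isoGaussian a σ S := (one_mul _).symm
      _ ≤ ENNReal.ofReal (Real.exp ε) * isoGaussian a σ S := by gcongr
      _ ≤ _ := le_self_add
  set v : EuclideanSpace ℝ (Fin d) := (σ ^ 2)⁻¹ • (a - b) with hv
  have hσ2 : (0 : ℝ) < σ ^ 2 := by positivity
  have hav : a = b + σ ^ 2 • v := by
    rw [hv, smul_smul, mul_inv_cancel₀ hσ2.ne', one_smul]; abel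
  set r2 : ℝ := σ ^ 2 * ‖v‖ ^ 2 with hr2
  have hnorm : 0 < ‖a - b‖ := norm_pos_iff.2 (sub_ne_zero.2 hab)
  have hr2' : r2 * σ ^ 2 = ‖a - b‖ ^ 2 := by
    rw [hr2, hv, norm_smul, Real.norm_eq_abs, abs_of_pos (by positivity)]
    field_simp
  clear_value v r2
  have hr2pos : 0 < r2 := by
    by_contra h
    have : r2 * σ ^ 2 ≤ 0 := mul_nonpos_of_nonpos_of_nonneg (not_lt.1 h) hσ2.le
    nlinarith [pow_pos hnorm 2]
  have h1' : r2 ≤ ε := by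
    rw [← hr2'] at h1; exact le_of_mul_le_mul_right h1 hσ2
  have h2' : 8 * Real.log (1 / δ) * r2 ≤ ε ^ 2 := by
    rw [← hr2', ← mul_assoc] at h2; exact le_of_mul_le_mul_right h2 hσ2
  -- The exponent to control is `-lε + l(l+1) r2 / 2`. For `l r2 = ε/2` and `r2 ≤ ε` it is at most
  -- `-lε/4 = -ε²/(8 r2)`, which explains the constant 8 in `h2`.
  set l : ℝ := ε / (2 * r2) with hl
  have hlpos : 0 < l := by positivity
  set L : EuclideanSpace ℝ (Fin d) → ℝ := fun x => ⟪v, x⟫ - (⟪v, b⟫ + r2 / 2) with hL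
  have key : ∀ x, ENNReal.ofReal (Real.exp (L x)) ≤
      ENNReal.ofReal (Real.exp ε) + ENNReal.ofReal (Real.exp ((l + 1) * L x - l * ε)) := by
    intro x
    rcases le_total (L x) ε with h | h
    · exact (ENNReal.ofReal_le_ofReal (Real.exp_le_exp.2 h)).trans le_self_add
    · refine (ENNReal.ofReal_le_ofReal (Real.exp_le_exp.2 ?_)).trans le_add_self
      nlinarith
  have hint : ∫⁻ x, ENNReal.ofReal (Real.exp ((l + 1) * L x - l * ε)) ∂(isoGaussian b σ) ≤
      ENNReal.ofReal δ := by
    have hfun : ∀ x, Real.exp ((l + 1) * L x - l * ε) =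
        Real.exp (-(l * ε) - (l + 1) * (⟪v, b⟫ + r2 / 2)) * Real.exp ⟪(l + 1) • v, x⟫ := by
      intro x
      rw [← Real.exp_add, real_inner_smul_left, hL]
      congr 1; ring
    simp_rw [hfun]
    rw [← ofReal_integral_eq_lintegral_ofReal
      ((integrable_exp_inner_isoGaussian b σ _).const_mul _) (ae_of_all _ fun x => by positivity),
      integral_const_mul, integral_exp_inner_isoGaussian, ← Real.exp_add]
    apply ENNReal.ofReal_le_ofReal
    rw [← Real.exp_log hδ]
    apply Real.exp_le_exp.2
    rw [real_inner_smul_left, norm_smul, mul_pow, Real.norm_eq_abs, sq_abs]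
    have h3 : σ ^ 2 * ((l + 1) ^ 2 * ‖v‖ ^ 2) = (l + 1) ^ 2 * r2 := by rw [hr2]; ring
    have h4 : l * r2 = ε / 2 := by rw [hl]; field_simp
    have h5 : 4 * Real.log (1 / δ) ≤ l * ε := by
      have : l * ε = ε ^ 2 / (2 * r2) := by rw [hl]; ring
      rw [this, le_div_iff₀ (by positivity)]
      linarith
    have h6 : Real.log (1 / δ) = -Real.log δ := by rw [one_div, Real.log_inv]
    have h7 : l * r2 ≤ l * ε := by gcongr
    have h8 : (l + 1) ^ 2 * r2 / 2 - (l + 1) * (r2 / 2) = l * (l * r2) / 2 + l * r2 / 2 := by ring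
    rw [h4] at h8
    rw [h3]
    linarith
  have happ : isoGaussian a σ S = ∫⁻ x in S, ENNReal.ofReal (Real.exp (L x)) ∂(isoGaussian b σ) := by
    rw [hav, ← isoGaussian_tilted, tilted_apply' _ _ hS, integral_exp_inner_isoGaussian]
    simp_rw [← Real.exp_sub]
    simp only [hL, hr2]
  rw [happ]
  calc _ ≤ ∫⁻ x in S, (ENNReal.ofReal (Real.exp ε) +
          ENNReal.ofReal (Real.exp ((l + 1) * L x - l * ε))) ∂(isoGaussian b σ) :=
        lintegral_mono key
    _ = ENNReal.ofReal (Real.exp ε) * isoGaussian b σ S +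
        ∫⁻ x in S, ENNReal.ofReal (Real.exp ((l + 1) * L x - l * ε)) ∂(isoGaussian b σ) := by
        rw [lintegral_add_left measurable_const, setLIntegral_const]
    _ ≤ _ := by
        gcongr
        exact (setLIntegral_le_lintegral _ _).trans hint

theorem agm_nonneg (d : ℕ) (Δ ε δ : ℝ) : 0 ≤ agm d Δ ε δ :=
  Real.sInf_nonneg fun _ h => h.1.le

theorem agm_le {Δ ε δ σ : ℝ} (hσ : 0 < σ)
    (h : ∀ a b : EuclideanSpace ℝ (Fin d), ‖a - b‖ ≤ Δ → ∀ S, MeasurableSet S →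
      isoGaussian a σ S ≤ ENNReal.ofReal (Real.exp ε) * isoGaussian b σ S + ENNReal.ofReal δ) :
    agm d Δ ε δ ≤ σ :=
  csInf_le ⟨0, fun _ h => h.1.le⟩ ⟨hσ, fun _ _ _ hq _ _ hD _ hS => h _ _ (hq _ _ hD) _ hS⟩

theorem isoGaussian_apply_le_of_norm_sub_le {Δ ε δ σ : ℝ} (hσ : 0 < σ) (hε : 0 < ε) (hδ : 0 < δ)
    (hδ1 : δ < 1) (h1 : Δ ^ 2 ≤ ε * σ ^ 2) (h2 : 8 * Real.log (1 / δ) * Δ ^ 2 ≤ ε ^ 2 * σ ^ 2)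
    (a b : EuclideanSpace ℝ (Fin d)) (hab : ‖a - b‖ ≤ Δ) (S : Set (EuclideanSpace ℝ (Fin d)))
    (hS : MeasurableSet S) :
    isoGaussian a σ S ≤ ENNReal.ofReal (Real.exp ε) * isoGaussian b σ S + ENNReal.ofReal δ := by
  have hsq : ‖a - b‖ ^ 2 ≤ Δ ^ 2 := by gcongr
  have hlog : 0 ≤ Real.log (1 / δ) := Real.log_nonneg (one_le_one_div hδ hδ1.le)
  refine isoGaussian_apply_le hσ hε hδ (hsq.trans h1) (le_trans ?_ h2) hS
  gcongr

/-- Needed for `δ` near 1, where `log(1/δ)` is close to 0 and the term `1/ε` of `sq_agm_le` is out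
of control. Noise `20 Δ` is `(1/5, 1/4)`-private; since `e^(1/5) ≤ 5/4` and probabilities are at
most 1, it is also `(0, 1/2)`-private. -/
theorem agm_le_of_half_le {Δ ε δ : ℝ} (hΔ : 0 < Δ) (hε : 0 < ε) (hδ : 1 / 2 ≤ δ) :
    agm d Δ ε δ ≤ 20 * Δ := by
  refine agm_le (by positivity) fun a b hab S hS => ?_
  have hlog : Real.log (1 / (1 / 4)) ≤ 2 := by
    have : Real.log 4 = 2 * Real.log 2 := by
      rw [show (4 : ℝ) = 2 ^ 2 by norm_num, Real.log_pow]; norm_num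
    norm_num only [this]
    linarith [Real.log_two_lt_d9]
  have h := isoGaussian_apply_le_of_norm_sub_le (d := d) (Δ := Δ) (ε := 1 / 5) (δ := 1 / 4)
    (σ := 20 * Δ) (by positivity) (by norm_num) (by norm_num) (by norm_num) (by nlinarith)
    (by nlinarith [mul_le_mul_of_nonneg_right hlog (sq_nonneg Δ)]) a b hab S hS
  refine h.trans ?_
  have h5 : Real.exp (1 / 5) ≤ 1 + 1 / 4 := by
    have := Real.exp_bound_div_one_sub_of_interval (x := 1 / 5) (by norm_num) (by norm_num)
    linarith
  have hp : isoGaussian b (20 * Δ) S ≤ 1 := prob_le_one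
  calc ENNReal.ofReal (Real.exp (1 / 5)) * isoGaussian b (20 * Δ) S + ENNReal.ofReal (1 / 4)
      ≤ ENNReal.ofReal (1 + 1 / 4) * isoGaussian b (20 * Δ) S + ENNReal.ofReal (1 / 4) := by
        gcongr
    _ = isoGaussian b (20 * Δ) S +
        (ENNReal.ofReal (1 / 4) * isoGaussian b (20 * Δ) S + ENNReal.ofReal (1 / 4)) := by
        rw [ENNReal.ofReal_add (by norm_num) (by norm_num), add_mul, ENNReal.ofReal_one, one_mul,
          add_assoc]
    _ ≤ isoGaussian b (20 * Δ) S + (ENNReal.ofReal (1 / 4) * 1 + ENNReal.ofReal (1 / 4)) := by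
        gcongr
    _ = isoGaussian b (20 * Δ) S + ENNReal.ofReal (1 / 2) := by
        rw [mul_one, ← ENNReal.ofReal_add (by norm_num) (by norm_num)]; norm_num
    _ ≤ 1 * isoGaussian b (20 * Δ) S + ENNReal.ofReal δ := by rw [one_mul]; gcongr
    _ ≤ _ := by
        gcongr
        exact ENNReal.one_le_ofReal.2 (Real.one_le_exp hε.le)

/-- The square of this scale is the sum of the two lower bounds on `σ²` required by the Chernoff
argument. It also shows that the infimum defining `agm` is over a nonempty set. -/
theorem sqrt_mem_agm_scales {Δ ε δ : ℝ} (hΔ : 0 < Δ) (hε : 0 < ε) (hδ : 0 < δ) (hδ1 : δ < 1) :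
    √(Δ ^ 2 * (1 / ε + 8 * Real.log (1 / δ) / ε ^ 2)) ∈ {σ : ℝ | 0 < σ ∧ ∀ (𝒴 : Type) (m : ℕ)
      (q : (Fin m → 𝒴) → EuclideanSpace ℝ (Fin d)),
      HasSensitivityLE q Δ → IsDP (fun D => isoGaussian (q D) σ) ε δ} := by
  have hlog : 0 ≤ Real.log (1 / δ) := Real.log_nonneg (one_le_one_div hδ hδ1.le)
  set s : ℝ := Δ ^ 2 * (1 / ε + 8 * Real.log (1 / δ) / ε ^ 2) with hs
  have hspos : 0 < s := by positivity
  refine ⟨Real.sqrt_pos.2 hspos, fun _ _ _ hq _ _ hD _ hS =>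
    isoGaussian_apply_le_of_norm_sub_le (Real.sqrt_pos.2 hspos) hε hδ hδ1 ?_ ?_ _ _
      (hq _ _ hD) _ hS⟩
  · rw [Real.sq_sqrt hspos.le, hs]
    have : ε * (Δ ^ 2 * (1 / ε + 8 * Real.log (1 / δ) / ε ^ 2)) =
      Δ ^ 2 + Δ ^ 2 * (8 * Real.log (1 / δ) / ε) := by field_simp
    rw [this]
    have : 0 ≤ Δ ^ 2 * (8 * Real.log (1 / δ) / ε) := by positivity
    linarith
  · rw [Real.sq_sqrt hspos.le, hs]
    have : ε ^ 2 * (Δ ^ 2 * (1 / ε + 8 * Real.log (1 / δ) / ε ^ 2)) =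
      Δ ^ 2 * ε + 8 * Real.log (1 / δ) * Δ ^ 2 := by field_simp
    rw [this]
    have : 0 ≤ Δ ^ 2 * ε := by positivity
    linarith

theorem sq_agm_le {Δ ε δ : ℝ} (hΔ : 0 < Δ) (hε : 0 < ε) (hδ : 0 < δ) (hδ1 : δ < 1) :
    agm d Δ ε δ ^ 2 ≤ Δ ^ 2 * (1 / ε + 8 * Real.log (1 / δ) / ε ^ 2) := by
  have hlog : 0 ≤ Real.log (1 / δ) := Real.log_nonneg (one_le_one_div hδ hδ1.le)
  have h : agm d Δ ε δ ≤ _ :=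
    csInf_le ⟨0, fun _ h => h.1.le⟩ (sqrt_mem_agm_scales (d := d) hΔ hε hδ hδ1)
  calc agm d Δ ε δ ^ 2 ≤ √(Δ ^ 2 * (1 / ε + 8 * Real.log (1 / δ) / ε ^ 2)) ^ 2 := by
        gcongr; exact agm_nonneg _ _ _ _
    _ = _ := Real.sq_sqrt (by positivity)

/-- A lower bound on the mass that a centered Gaussian puts next to its mean. -/
theorem le_gaussianReal_Ico {Δ σ : ℝ} (hΔ : 0 < Δ) (hσ : 0 < σ) :
    Real.exp (-1 / 2) / √(2 * Real.pi) * min (Δ / σ) 1 ≤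
      (gaussianReal 0 (σ ^ 2).toNNReal).real (Set.Ico (-Δ) 0) := by
  -- On `[-w, 0)` one has `|x| ≤ σ`, so the density is at least `e^(-1/2) / (√(2π) σ)`.
  set w := min Δ σ with hw
  have hwpos : 0 < w := lt_min hΔ hσ
  have hv : (σ ^ 2).toNNReal ≠ 0 := by simpa using hσ.ne'
  have hsub : Set.Ico (-w) 0 ⊆ Set.Ico (-Δ) 0 :=
    Set.Ico_subset_Ico_left (neg_le_neg (min_le_left _ _))
  refine le_trans ?_ (measureReal_mono hsub)
  rw [measureReal_def, gaussianReal_apply_eq_integral _ hv, ENNReal.toReal_ofReal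
    (integral_nonneg fun _ => gaussianPDFReal_nonneg _ _ _)]
  set c : ℝ := Real.exp (-1 / 2) / √(2 * Real.pi) / σ with hc
  have hle : ∀ x ∈ Set.Ico (-w) 0, c ≤ gaussianPDFReal 0 (σ ^ 2).toNNReal x := by
    intro x hx
    have hxσ : x ^ 2 ≤ σ ^ 2 := by
      have : -σ ≤ x := (neg_le_neg (min_le_right _ _)).trans hx.1
      nlinarith [hx.2]
    rw [gaussianPDFReal, Real.coe_toNNReal _ (sq_nonneg σ), Real.sqrt_mul' _ (sq_nonneg σ),
      Real.sqrt_sq hσ.le, hc, div_div, div_eq_inv_mul]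
    refine mul_le_mul_of_nonneg_left (Real.exp_le_exp.2 ?_) (by positivity)
    rw [sub_zero, neg_div, neg_div, neg_le_neg_iff, div_le_div_iff₀ (by positivity) (by norm_num)]
    linarith
  have hconst : ∫ _ in Set.Ico (-w) 0, c = c * w := by
    rw [setIntegral_const, measureReal_def, Real.volume_Ico, ENNReal.toReal_ofReal (by linarith)]
    simp [mul_comm]
  calc _ = c * w := by
        rw [hc, hw, ← div_self hσ.ne', min_div_div_right hσ.le]; ring
    _ = ∫ _ in Set.Ico (-w) 0, c := hconst.symm
    _ ≤ _ := setIntegral_mono_on (by simp) (integrable_gaussianPDFReal _ _).integrableOn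
        measurableSet_Ico hle

/-- Test privacy on a single bit, sent to `0` or to `Δ e` with `e` a unit vector, and on the
half-space `⟪e, x⟫ ≥ 0`. Its two probabilities differ by the `N(0, σ²)`-mass of `[-Δ, 0)`, while
privacy bounds the difference by `(e^ε - 1) + δ`. -/
theorem scale_lower_bound (hd : 0 < d) {Δ ε δ σ : ℝ} (hΔ : 0 < Δ) (hσ : 0 < σ) (hε : 0 < ε)
    (hδ : 0 < δ)
    (h : ∀ (𝒴 : Type) (m : ℕ) (q : (Fin m → 𝒴) → EuclideanSpace ℝ (Fin d)),
      HasSensitivityLE q Δ → IsDP (fun D => isoGaussian (q D) σ) ε δ) :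
    Real.exp (-1 / 2) / √(2 * Real.pi) * min (Δ / σ) 1 ≤ (Real.exp ε - 1) + δ := by
  set e : EuclideanSpace ℝ (Fin d) := EuclideanSpace.single ⟨0, hd⟩ 1 with he
  have hne : ‖e‖ = 1 := by simp [he]
  have hsens : HasSensitivityLE (fun D : Fin 1 → Bool => if D 0 then Δ • e else 0) Δ := by
    intro D D' _
    have h0 : ‖Δ • e‖ = Δ := by rw [norm_smul, hne, mul_one, Real.norm_eq_abs, abs_of_pos hΔ]
    cases hD : D 0 <;> cases hD' : D' 0 <;> simp [hD, hD', h0, hΔ.le]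
  have hS : MeasurableSet ((fun x => ⟪e, x⟫) ⁻¹' Set.Ici (0 : ℝ)) :=
    measurableSet_Ici.preimage (by fun_prop)
  have hdp := h Bool 1 _ hsens (fun _ => true) (fun _ => false)
    ⟨0, fun j hj => absurd (Subsingleton.elim j 0) hj⟩ _ hS
  simp only [if_true, Bool.false_eq_true, if_false] at hdp
  rw [← Measure.map_apply (by fun_prop) measurableSet_Ici,
    ← Measure.map_apply (by fun_prop) measurableSet_Ici, isoGaussian_map_inner,
    isoGaussian_map_inner, real_inner_smul_right, real_inner_self_eq_norm_sq, hne, inner_zero_right,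
    one_pow, mul_one, mul_one] at hdp
  set μ := gaussianReal 0 (σ ^ 2).toNNReal
  have hshift : gaussianReal Δ (σ ^ 2).toNNReal (Set.Ici 0) = μ (Set.Ici (-Δ)) := by
    have := gaussianReal_map_add_const (μ := 0) (v := (σ ^ 2).toNNReal) Δ
    rw [zero_add] at this
    rw [← this, Measure.map_apply (by fun_prop) measurableSet_Ici]
    congr 1
    ext x; simp [neg_le_iff_add_nonneg]
  rw [hshift] at hdp
  have hsplit : μ.real (Set.Ici (-Δ)) = μ.real (Set.Ico (-Δ) 0) + μ.real (Set.Ici 0) := by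
    rw [← measureReal_union _ measurableSet_Ici, Set.Ico_union_Ici_eq_Ici (by linarith)]
    exact Set.disjoint_left.2 fun x hx hx' => not_le.2 hx.2 hx'
  have hreal : μ.real (Set.Ici (-Δ)) ≤ Real.exp ε * μ.real (Set.Ici 0) + δ := by
    have := ENNReal.toReal_mono (by finiteness) hdp
    rwa [ENNReal.toReal_add (by finiteness) (by finiteness), ENNReal.toReal_mul,
      ENNReal.toReal_ofReal (Real.exp_pos _).le, ENNReal.toReal_ofReal hδ.le] at this
  have hone : μ.real (Set.Ici 0) ≤ 1 := measureReal_le_one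
  refine (le_gaussianReal_Ico hΔ hσ).trans ?_
  have : (Real.exp ε - 1) * μ.real (Set.Ici 0) ≤ (Real.exp ε - 1) * 1 := by
    gcongr
    linarith [Real.one_le_exp hε.le]
  change μ.real _ ≤ _
  linarith

/-- A lower bound on the calibrated noise scale. -/
theorem le_agm (hd : 0 < d) {Δ ε δ κ : ℝ} (hΔ : 0 < Δ) (hε : 0 < ε) (hδ : 0 < δ) (hδ1 : δ < 1)
    (hκ : (Real.exp ε - 1) + δ ≤ κ) (hκ1 : κ < Real.exp (-1 / 2) / √(2 * Real.pi)) :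
    Real.exp (-1 / 2) / √(2 * Real.pi) * Δ / κ ≤ agm d Δ ε δ := by
  have hκpos : 0 < κ := lt_of_lt_of_le (by linarith [Real.one_le_exp hε.le]) hκ
  refine le_csInf ⟨_, sqrt_mem_agm_scales hΔ hε hδ hδ1⟩ fun σ hσ => ?_
  have h := (scale_lower_bound hd hΔ hσ.1 hε hδ hσ.2).trans hκ
  -- If `σ ≤ Δ`, the minimum is 1 and the bound contradicts `hκ1`.
  rcases le_total (Δ / σ) 1 with h1 | h1
  · rw [min_eq_left h1, ← mul_div_assoc, div_le_iff₀ hσ.1] at h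
    rw [div_le_iff₀ hκpos]; linarith
  · rw [min_eq_right h1] at h
    linarith

/-! ### Asymptotics of the calibrated noise scale -/

theorem tendsto_mul_sq_agm_zero {B : ℝ} (hB : 0 < B) {ε δ : ℕ → ℝ} (hε : ∀ᶠ n in atTop, 0 < ε n)
    (hδ : ∀ᶠ n in atTop, 0 < δ n ∧ δ n < 1)
    (h : Tendsto (fun n : ℕ => n * ε n ^ 2 / Real.log (1 / δ n)) atTop atTop) :
    Tendsto (fun n : ℕ => n * agm d (2 * B / n) (ε n) (δ n) ^ 2) atTop (𝓝 0) := by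
  set w := fun n : ℕ => n * ε n ^ 2 / Real.log (1 / δ n) with hw
  have hub : Tendsto (fun n : ℕ => 1600 * B ^ 2 * (n : ℝ)⁻¹ +
      4 * B ^ 2 * ((√(n * (w n * Real.log 2)))⁻¹ + 8 * (w n)⁻¹)) atTop (𝓝 0) := by
    have hn : Tendsto (fun n : ℕ => (n : ℝ)⁻¹) atTop (𝓝 0) := tendsto_inv_atTop_nhds_zero_nat
    have h1 : Tendsto (fun n : ℕ => (√(n * (w n * Real.log 2)))⁻¹) atTop (𝓝 0) := by
      refine tendsto_inv_atTop_zero.comp (Real.tendsto_sqrt_atTop.comp ?_)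
      exact tendsto_natCast_atTop_atTop.atTop_mul_atTop₀
        (h.atTop_mul_const (Real.log_pos one_lt_two))
    have h2 : Tendsto (fun n : ℕ => (w n)⁻¹) atTop (𝓝 0) := tendsto_inv_atTop_zero.comp h
    simpa using (hn.const_mul (1600 * B ^ 2)).add ((h1.add (h2.const_mul 8)).const_mul (4 * B ^ 2))
  refine squeeze_zero' (Eventually.of_forall fun n => by positivity) ?_ hub
  filter_upwards [hε, hδ, eventually_gt_atTop 0, h.eventually_gt_atTop 0] with n hεn hδn hn hwn
  have hn' : (0 : ℝ) < n := by exact_mod_cast hn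
  have hΔ : 0 < 2 * B / n := by positivity
  have hA := agm_nonneg d (2 * B / n) (ε n) (δ n)
  -- For `δ < 1/2` one has `log(1/δ) ≥ log 2`, hence `(nε)² = n w log(1/δ) ≥ n w log 2`. This drives
  -- the `1/ε` contribution, which is `4B²/(nε)`, to 0.
  rcases le_or_gt (1 / 2) (δ n) with hδh | hδh
  · have h1 := agm_le_of_half_le (d := d) hΔ hεn hδh
    calc n * agm d (2 * B / n) (ε n) (δ n) ^ 2 ≤ n * (20 * (2 * B / n)) ^ 2 := by gcongr
      _ = 1600 * B ^ 2 * (n : ℝ)⁻¹ := by field_simp; ring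
      _ ≤ _ := le_add_of_nonneg_right (by positivity)
  · have h1 := sq_agm_le (d := d) hΔ hεn hδn.1 hδn.2
    have hlog2 : Real.log 2 ≤ Real.log (1 / δ n) :=
      Real.log_le_log two_pos (by rw [le_div_iff₀ hδn.1]; linarith)
    have hlogpos : 0 < Real.log (1 / δ n) := (Real.log_pos one_lt_two).trans_le hlog2
    have hnε : n * ε n ^ 2 = w n * Real.log (1 / δ n) := by
      rw [hw]; field_simp
    have h2 : √(n * (w n * Real.log 2)) ≤ n * ε n := by
      rw [Real.sqrt_le_left (by positivity)]
      calc n * (w n * Real.log 2) ≤ n * (w n * Real.log (1 / δ n)) := by gcongr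
        _ = (n * ε n) ^ 2 := by rw [← hnε]; ring
    calc n * agm d (2 * B / n) (ε n) (δ n) ^ 2
        ≤ n * ((2 * B / n) ^ 2 * (1 / ε n + 8 * Real.log (1 / δ n) / ε n ^ 2)) := by gcongr
      _ = 4 * B ^ 2 * ((n * ε n)⁻¹ + 8 * (w n)⁻¹) := by
        rw [hw]; field_simp; norm_num
      _ ≤ 4 * B ^ 2 * ((√(n * (w n * Real.log 2)))⁻¹ + 8 * (w n)⁻¹) := by
        gcongr
      _ ≤ _ := le_add_of_nonneg_left (by positivity)

/-- Here `e^ε - 1 + δ ≤ K/√n`, and `le_agm` with `Δ = 2B/n` gives `σ ≥ (2 B c₀ / K) / √n`. -/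
theorem eventually_le_mul_sq_agm (hd : 0 < d) {B : ℝ} (hB : 0 < B) {ε δ : ℕ → ℝ}
    (hε : ∀ᶠ n in atTop, 0 < ε n) (hδ : ∀ᶠ n in atTop, 0 < δ n ∧ δ n < 1)
    (h1 : ∃ C : ℝ, ∀ᶠ n : ℕ in atTop, n * ε n ^ 2 ≤ C)
    (h2 : ∃ C : ℝ, ∀ᶠ n : ℕ in atTop, √(n : ℝ) * δ n ≤ C) :
    ∃ c : ℝ, 0 < c ∧ ∀ᶠ n : ℕ in atTop, c ≤ n * agm d (2 * B / n) (ε n) (δ n) ^ 2 := by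
  obtain ⟨C₁, h1⟩ := h1
  obtain ⟨C₂, h2⟩ := h2
  set c₀ : ℝ := Real.exp (-1 / 2) / √(2 * Real.pi) with hc₀
  have hc₀pos : 0 < c₀ := by positivity
  -- The 2 comes from `e^ε - 1 ≤ 2ε` for `ε ≤ 1`; the maxima with 1 keep `K` positive whatever the
  -- signs of `C₁` and `C₂`.
  set K : ℝ := 2 * √(max C₁ 1) + max C₂ 1 with hK
  have hKpos : 0 < K := by positivity
  refine ⟨(2 * B * c₀ / K) ^ 2, by positivity, ?_⟩
  have hsq : Tendsto (fun n : ℕ => √(n : ℝ)) atTop atTop :=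
    Real.tendsto_sqrt_atTop.comp tendsto_natCast_atTop_atTop
  filter_upwards [hε, hδ, h1, h2, hsq.eventually_gt_atTop (K / c₀), hsq.eventually_ge_atTop K,
    eventually_gt_atTop 0] with n hεn hδn h1n h2n hn1 hn2 hn
  have hn' : (0 : ℝ) < n := by exact_mod_cast hn
  have hs : 0 < √(n : ℝ) := Real.sqrt_pos.2 hn'
  have hss : √(n : ℝ) * √(n : ℝ) = n := Real.mul_self_sqrt hn'.le
  have hεs : √(n : ℝ) * ε n ≤ √(max C₁ 1) := by
    apply Real.le_sqrt_of_sq_le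
    rw [mul_pow, Real.sq_sqrt hn'.le]
    exact h1n.trans (le_max_left _ _)
  have hε1 : ε n ≤ 1 := by
    have : √(n : ℝ) * ε n ≤ √(n : ℝ) * 1 := by
      have : √(max C₁ 1) ≤ K := by
        rw [hK]; linarith [Real.sqrt_nonneg (max C₁ 1), le_max_right C₂ 1]
      linarith
    exact le_of_mul_le_mul_left this hs
  have hexp : Real.exp (ε n) - 1 ≤ 2 * ε n := by
    have := Real.abs_exp_sub_one_le (x := ε n) (by rwa [abs_of_pos hεn])
    rw [abs_of_pos hεn] at this
    exact (le_abs_self _).trans this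
  have hκ : Real.exp (ε n) - 1 + δ n ≤ K / √(n : ℝ) := by
    rw [le_div_iff₀ hs]
    have := le_max_left C₂ 1
    have := mul_le_mul_of_nonneg_right hexp hs.le
    rw [hK]; linarith
  have hκ1 : K / √(n : ℝ) < c₀ := by
    rw [div_lt_iff₀ hs]
    rw [div_lt_iff₀ hc₀pos] at hn1
    linarith
  have hle := le_agm hd (Δ := 2 * B / n) (by positivity) hεn hδn.1 hδn.2 hκ hκ1
  have heq : c₀ * (2 * B / n) / (K / √(n : ℝ)) = (2 * B * c₀ / K) / √(n : ℝ) := by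
    field_simp
    rw [Real.sq_sqrt hn'.le]
  rw [← hc₀, heq] at hle
  calc (2 * B * c₀ / K) ^ 2 = n * (2 * B * c₀ / K / √(n : ℝ)) ^ 2 := by
        rw [div_pow _ (√(n : ℝ)), Real.sq_sqrt hn'.le]; field_simp
    _ ≤ _ := by gcongr

end GaussianMechanism

/-! ### Smoothness of the log-partition function of a bounded exponential family -/

namespace ExpFamily

variable {𝒳 : Type*} [MeasurableSpace 𝒳] {d : ℕ} (M : ExpFamily 𝒳 d)

/-- The unnormalized expectation `∫ h(x) exp ⟨θ, s(x)⟩ g(x) dx`. -/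
def expInt {F : Type*} [NormedAddCommGroup F] [NormedSpace ℝ F] (g : 𝒳 → F)
    (θ : EuclideanSpace ℝ (Fin d)) : F :=
  ∫ x, (M.h x * Real.exp ⟪θ, M.s x⟫) • g x ∂M.base

/-- The sufficient statistic is bounded, and the dominating density is integrable and nonzero. -/
structure IsBounded (B : ℝ) : Prop where
  norm_s_le : ∀ x, ‖M.s x‖ ≤ B
  integrable_h : Integrable M.h M.base
  h_ne_zero : ¬ M.h =ᵐ[M.base] 0

variable {M} {B : ℝ}

/-- As `s` is bounded, `exp ⟪θ, s⟫ ≥ exp(-‖θ‖ B)`, so integrability at one parameter gives that of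
`h`. If `h` vanished a.e., every affine relation would hold a.e., against minimality for a unit
vector. -/
theorem isBounded_of_mem_naturalSpace (hd : 0 < d) (hs : ∀ x, ‖M.s x‖ ≤ B)
    (hM : M.IsMinimalRegular) {θ : EuclideanSpace ℝ (Fin d)} (hθ : θ ∈ M.naturalSpace) :
    M.IsBounded B where
  norm_s_le := hs
  integrable_h := by
    have hθ' : Integrable (fun x => M.h x * Real.exp ⟪θ, M.s x⟫) M.base := hθ
    refine (hθ'.const_mul (Real.exp (‖θ‖ * B))).mono' M.measurable_h.aestronglyMeasurable
      (ae_of_all _ fun x => ?_)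
    rw [Real.norm_eq_abs, abs_of_nonneg (M.h_nonneg x)]
    have h1 : -(‖θ‖ * B) ≤ ⟪θ, M.s x⟫ := by
      have := neg_le_of_abs_le (abs_real_inner_le_norm θ (M.s x))
      have := mul_le_mul_of_nonneg_left (hs x) (norm_nonneg θ)
      linarith
    have h2 : 1 ≤ Real.exp (‖θ‖ * B) * Real.exp ⟪θ, M.s x⟫ := by
      rw [← Real.exp_add]; exact Real.one_le_exp (by linarith)
    calc M.h x = M.h x * 1 := (mul_one _).symm
      _ ≤ M.h x * (Real.exp (‖θ‖ * B) * Real.exp ⟪θ, M.s x⟫) :=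
        mul_le_mul_of_nonneg_left h2 (M.h_nonneg x)
      _ = _ := by ring
  h_ne_zero := fun h0 => by
    have : EuclideanSpace.single (⟨0, hd⟩ : Fin d) (1 : ℝ) = 0 := by
      refine hM.minimal _ 0 ?_
      rw [ae_withDensity_iff M.measurable_h.ennreal_ofReal]
      filter_upwards [h0] with x hx hne
      simp [hx] at hne
    have h1 := congrArg norm this
    simp at h1

namespace IsBounded

theorem measurable_weight (θ : EuclideanSpace ℝ (Fin d)) :
    Measurable (fun x => M.h x * Real.exp ⟪θ, M.s x⟫) :=
  M.measurable_h.mul (Measurable.const_inner M.measurable_s).exp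

theorem nonneg_bound (hb : M.IsBounded B) : 0 ≤ B := by
  by_contra h
  refine hb.h_ne_zero (ae_of_all _ fun x => ?_)
  exact absurd ((norm_nonneg _).trans (hb.norm_s_le x)) h

theorem weight_le (hb : M.IsBounded B) {R : ℝ} {θ : EuclideanSpace ℝ (Fin d)} (hθ : ‖θ‖ ≤ R)
    (x : 𝒳) :
    M.h x * Real.exp ⟪θ, M.s x⟫ ≤ M.h x * Real.exp (R * B) := by
  refine mul_le_mul_of_nonneg_left (Real.exp_le_exp.2 ?_) (M.h_nonneg x)
  calc ⟪θ, M.s x⟫ ≤ ‖θ‖ * ‖M.s x‖ := real_inner_le_norm _ _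
    _ ≤ R * B := mul_le_mul hθ (hb.norm_s_le x) (norm_nonneg _) ((norm_nonneg _).trans hθ)

theorem weight_nonneg (θ : EuclideanSpace ℝ (Fin d)) (x : 𝒳) :
    0 ≤ M.h x * Real.exp ⟪θ, M.s x⟫ := mul_nonneg (M.h_nonneg x) (Real.exp_pos _).le

variable {F : Type*} [NormedAddCommGroup F] [NormedSpace ℝ F] {g : 𝒳 → F} {C : ℝ}

theorem integrable_weight_smul (hb : M.IsBounded B) (hg : AEStronglyMeasurable g M.base)
    (hC : ∀ x, ‖g x‖ ≤ C)
    (θ : EuclideanSpace ℝ (Fin d)) :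
    Integrable (fun x => (M.h x * Real.exp ⟪θ, M.s x⟫) • g x) M.base := by
  refine (hb.integrable_h.mul_const (Real.exp (‖θ‖ * B) * C)).mono'
    ((measurable_weight θ).aestronglyMeasurable.smul hg) (ae_of_all _ fun x => ?_)
  rw [norm_smul, Real.norm_eq_abs, abs_of_nonneg (weight_nonneg θ x), ← mul_assoc]
  exact mul_le_mul (hb.weight_le le_rfl x) (hC x) (norm_nonneg _)
    (mul_nonneg (M.h_nonneg x) (Real.exp_pos _).le)

theorem integrable_weight (hb : M.IsBounded B) (θ : EuclideanSpace ℝ (Fin d)) :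
    Integrable (fun x => M.h x * Real.exp ⟪θ, M.s x⟫) M.base := by
  simpa using hb.integrable_weight_smul (g := fun _ => (1 : ℝ)) (C := 1)
    aestronglyMeasurable_const (by simp) θ

theorem aestronglyMeasurable_s : AEStronglyMeasurable M.s M.base :=
  M.measurable_s.aestronglyMeasurable

theorem aestronglyMeasurable_smulRight (hg : AEStronglyMeasurable g M.base) :
    AEStronglyMeasurable (fun x => (innerSL ℝ (M.s x)).smulRight (g x)) M.base :=
  (ContinuousLinearMap.smulRightL ℝ (EuclideanSpace ℝ (Fin d)) F).aestronglyMeasurable_comp₂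
    ((innerSL ℝ).continuous.comp_aestronglyMeasurable aestronglyMeasurable_s) hg

theorem norm_smulRight_le (hb : M.IsBounded B) (hC : ∀ x, ‖g x‖ ≤ C) (x : 𝒳) :
    ‖(innerSL ℝ (M.s x)).smulRight (g x)‖ ≤ B * C := by
  rw [ContinuousLinearMap.norm_smulRight_apply, innerSL_apply_norm]
  exact mul_le_mul (hb.norm_s_le x) (hC x) (norm_nonneg _) hb.nonneg_bound

/-- The derivative is again of the form `expInt`, with the bounded integrand `s ⊗ g`. The lemma can
therefore be iterated, and it yields continuity of the derivatives as well. -/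
theorem hasFDerivAt_expInt (hb : M.IsBounded B) (hg : AEStronglyMeasurable g M.base)
    (hC : ∀ x, ‖g x‖ ≤ C)
    (θ : EuclideanSpace ℝ (Fin d)) :
    HasFDerivAt (M.expInt g) (M.expInt (fun x => (innerSL ℝ (M.s x)).smulRight (g x)) θ) θ := by
  refine hasFDerivAt_integral_of_dominated_of_fderiv_le (s := Metric.ball θ 1)
    (bound := fun x => M.h x * (Real.exp ((‖θ‖ + 1) * B) * (B * C)))
    (F' := fun θ x => (M.h x * Real.exp ⟪θ, M.s x⟫) • (innerSL ℝ (M.s x)).smulRight (g x))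
    (Metric.ball_mem_nhds θ one_pos) ?_ (hb.integrable_weight_smul hg hC θ) ?_ ?_
    (hb.integrable_h.mul_const _) ?_
  · exact Eventually.of_forall fun θ => (measurable_weight θ).aestronglyMeasurable.smul hg
  · exact (measurable_weight θ).aestronglyMeasurable.smul (aestronglyMeasurable_smulRight hg)
  · refine ae_of_all _ fun x t ht => ?_
    have htn : ‖t‖ ≤ ‖θ‖ + 1 := by
      have := norm_le_norm_add_norm_sub θ t
      rw [← dist_eq_norm, dist_comm] at this
      linarith [Metric.mem_ball.1 ht]
    rw [norm_smul, Real.norm_eq_abs, abs_of_nonneg (weight_nonneg t x), ← mul_assoc]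
    refine mul_le_mul (hb.weight_le htn x) ?_ (norm_nonneg _)
      (mul_nonneg (M.h_nonneg x) (Real.exp_pos _).le)
    exact hb.norm_smulRight_le hC x
  · refine ae_of_all _ fun x t _ => ?_
    have h1 : HasFDerivAt (fun t : EuclideanSpace ℝ (Fin d) => ⟪t, M.s x⟫)
        (innerSL ℝ (M.s x)) t := by
      have := (innerSL ℝ (M.s x)).hasFDerivAt (x := t)
      refine this.congr_of_eventuallyEq (Eventually.of_forall fun y => ?_)
      simp [real_inner_comm]
    have h2 := ((h1.exp.const_mul (M.h x)).smul_const (g x))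
    convert h2 using 1
    ext v
    simp [smul_smul, mul_assoc]

theorem continuous_expInt (hb : M.IsBounded B) (hg : AEStronglyMeasurable g M.base)
    (hC : ∀ x, ‖g x‖ ≤ C) :
    Continuous (M.expInt g) :=
  continuous_iff_continuousAt.2 fun θ => (hb.hasFDerivAt_expInt hg hC θ).continuousAt

theorem map_expInt (hb : M.IsBounded B) {G : Type*} [NormedAddCommGroup G] [NormedSpace ℝ G]
    [CompleteSpace F] [CompleteSpace G] (hg : AEStronglyMeasurable g M.base) (hC : ∀ x, ‖g x‖ ≤ C)
    (θ : EuclideanSpace ℝ (Fin d)) (T : F →L[ℝ] G) :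
    T (M.expInt g θ) = M.expInt (fun x => T (g x)) θ := by
  unfold expInt
  rw [← T.integral_comp_comm (hb.integrable_weight_smul hg hC θ)]
  simp

theorem expInt_smulRight_apply (hb : M.IsBounded B) [CompleteSpace F]
    (hg : AEStronglyMeasurable g M.base) (hC : ∀ x, ‖g x‖ ≤ C) (θ v : EuclideanSpace ℝ (Fin d)) :
    M.expInt (fun x => (innerSL ℝ (M.s x)).smulRight (g x)) θ v =
      M.expInt (fun x => ⟪M.s x, v⟫ • g x) θ := by
  have := hb.map_expInt (aestronglyMeasurable_smulRight hg) (hb.norm_smulRight_le hC) θ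
    (ContinuousLinearMap.apply ℝ F v)
  simpa using this

/-! The normalization constant. -/

theorem expInt_one_pos (hb : M.IsBounded B) (θ : EuclideanSpace ℝ (Fin d)) :
    0 < M.expInt (fun _ => (1 : ℝ)) θ := by
  have h0 : 0 ≤ M.expInt (fun _ => (1 : ℝ)) θ :=
    integral_nonneg fun x => by simpa using weight_nonneg θ x
  refine lt_of_le_of_ne h0 fun h => hb.h_ne_zero ?_
  have := (integral_eq_zero_iff_of_nonneg (fun x => by simpa using weight_nonneg θ x)
    (hb.integrable_weight_smul aestronglyMeasurable_const (C := 1) (by simp) θ)).1 h.symm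
  filter_upwards [this] with x hx
  simpa [(Real.exp_pos _).ne'] using hx

theorem exp_logPartition (hb : M.IsBounded B) (θ : EuclideanSpace ℝ (Fin d)) :
    Real.exp (M.logPartition θ) = M.expInt (fun _ => (1 : ℝ)) θ := by
  have : M.expInt (fun _ => (1 : ℝ)) θ = ∫ x, M.h x * Real.exp ⟪θ, M.s x⟫ ∂M.base := by
    simp [expInt]
  rw [logPartition, ← this, Real.exp_log (hb.expInt_one_pos θ)]

theorem integral_law (hb : M.IsBounded B) (g : 𝒳 → F) (θ : EuclideanSpace ℝ (Fin d)) :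
    ∫ x, g x ∂(M.law θ) = (M.expInt (fun _ => (1 : ℝ)) θ)⁻¹ • M.expInt g θ := by
  have hmeas : Measurable (M.density θ) :=
    M.measurable_h.mul (((Measurable.const_inner M.measurable_s).sub_const _).exp)
  have hnn : ∀ x, 0 ≤ M.density θ x := fun x => mul_nonneg (M.h_nonneg x) (Real.exp_pos _).le
  rw [law, integral_withDensity_eq_integral_toReal_smul hmeas.ennreal_ofReal (by simp)]
  unfold expInt
  rw [← integral_smul]
  refine integral_congr_ae (ae_of_all _ fun x => ?_)
  simp only
  rw [ENNReal.toReal_ofReal (hnn x), smul_smul, density, Real.exp_sub, hb.exp_logPartition]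
  unfold expInt
  congr 1
  ring

theorem hasGradientAt_logPartition (hb : M.IsBounded B) (θ : EuclideanSpace ℝ (Fin d)) :
    HasGradientAt M.logPartition ((M.expInt (fun _ => (1 : ℝ)) θ)⁻¹ • M.expInt M.s θ) θ := by
  have h1 := hb.hasFDerivAt_expInt (g := fun _ => (1 : ℝ)) aestronglyMeasurable_const (C := 1)
    (by simp) θ
  have h2 := h1.log (hb.expInt_one_pos θ).ne'
  have h3 : (fun t => Real.log (M.expInt (fun _ => (1 : ℝ)) t)) = M.logPartition := by
    ext t; rw [← hb.exp_logPartition, Real.log_exp]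
  rw [h3] at h2
  rw [hasGradientAt_iff_hasFDerivAt]
  refine h2.congr_fderiv ?_
  ext1 v
  rw [smul_apply, hb.expInt_smulRight_apply aestronglyMeasurable_const (C := 1) (by simp),
    InnerProductSpace.toDual_apply_apply, real_inner_smul_left, real_inner_comm,
    ← innerSL_apply_apply ℝ, hb.map_expInt aestronglyMeasurable_s hb.norm_s_le]
  simp [real_inner_comm]

theorem meanMap_eq (hb : M.IsBounded B) (θ : EuclideanSpace ℝ (Fin d)) :
    M.meanMap θ = (M.expInt (fun _ => (1 : ℝ)) θ)⁻¹ • M.expInt M.s θ :=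
  (hb.hasGradientAt_logPartition θ).gradient

end IsBounded

end ExpFamily

/-! ### The mean map, its derivative and the Fisher information -/

namespace ExpFamily

variable {𝒳 : Type*} [MeasurableSpace 𝒳] {d : ℕ} {M : ExpFamily 𝒳 d} {B : ℝ}

namespace IsBounded

theorem isProbabilityMeasure_law (hb : M.IsBounded B) (θ : EuclideanSpace ℝ (Fin d)) :
    IsProbabilityMeasure (M.law θ) := by
  have h := hb.integral_law (fun _ => (1 : ℝ)) θ
  rw [smul_eq_mul, inv_mul_cancel₀ (hb.expInt_one_pos θ).ne', integral_const, smul_eq_mul,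
    mul_one, measureReal_def] at h
  exact ⟨(ENNReal.toReal_eq_one_iff _).1 h⟩

theorem meanMap_eq_integral (hb : M.IsBounded B) (θ : EuclideanSpace ℝ (Fin d)) :
    M.meanMap θ = ∫ x, M.s x ∂(M.law θ) := by
  rw [hb.integral_law, hb.meanMap_eq]

/-- Quotient rule for `∇A = G/Z`. The derivative is continuous in the parameter, hence strict, as
the inverse function theorem requires. -/
theorem exists_hasStrictFDerivAt_meanMap (hb : M.IsBounded B) (θ : EuclideanSpace ℝ (Fin d)) :
    ∃ J : EuclideanSpace ℝ (Fin d) →L[ℝ] EuclideanSpace ℝ (Fin d),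
      HasStrictFDerivAt M.meanMap J θ ∧
      ∀ v, J v = (∫ x, ⟪M.s x, v⟫ • M.s x ∂(M.law θ)) - ⟪M.meanMap θ, v⟫ • M.meanMap θ := by
  set Z := M.expInt (fun _ => (1 : ℝ)) with hZ
  set G := M.expInt M.s with hG
  set Z' := M.expInt (fun x => (innerSL ℝ (M.s x)).smulRight (1 : ℝ)) with hZ'
  set G' := M.expInt (fun x => (innerSL ℝ (M.s x)).smulRight (M.s x)) with hG'
  have hone : ∀ x : 𝒳, ‖(1 : ℝ)‖ ≤ 1 := by simp
  have cZ : Continuous Z := hb.continuous_expInt aestronglyMeasurable_const hone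
  have cG : Continuous G := hb.continuous_expInt aestronglyMeasurable_s hb.norm_s_le
  have cZ' : Continuous Z' := hb.continuous_expInt
    (aestronglyMeasurable_smulRight aestronglyMeasurable_const) (hb.norm_smulRight_le hone)
  have cG' : Continuous G' := hb.continuous_expInt
    (aestronglyMeasurable_smulRight aestronglyMeasurable_s) (hb.norm_smulRight_le hb.norm_s_le)
  have hZne : ∀ t, Z t ≠ 0 := fun t => (hb.expInt_one_pos t).ne'
  let J := fun t => (Z t)⁻¹ • G' t + ((-(Z t ^ 2)⁻¹) • Z' t).smulRight (G t)
  have hmean : M.meanMap = fun t => (Z t)⁻¹ • G t := funext hb.meanMap_eq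
  have hJ : ∀ t, HasFDerivAt M.meanMap (J t) t := by
    intro t
    rw [hmean]
    have h1 : HasFDerivAt Z (Z' t) t :=
      hb.hasFDerivAt_expInt aestronglyMeasurable_const hone t
    have h2 : HasFDerivAt G (G' t) t := hb.hasFDerivAt_expInt aestronglyMeasurable_s hb.norm_s_le t
    exact ((hasDerivAt_inv (hZne t)).comp_hasFDerivAt t h1).smul h2
  have cJ : Continuous J := by
    have c1 : Continuous fun t => (Z t)⁻¹ := cZ.inv₀ hZne
    have c2 : Continuous fun t => (Z t ^ 2)⁻¹ := (cZ.pow 2).inv₀ fun t => pow_ne_zero 2 (hZne t)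
    exact (c1.smul cG').add ((ContinuousLinearMap.smulRightL ℝ (EuclideanSpace ℝ (Fin d))
      (EuclideanSpace ℝ (Fin d))).continuous₂.comp₂ (c2.neg.smul cZ') cG)
  refine ⟨J θ, hasStrictFDerivAt_of_hasFDerivAt_of_continuousAt (Eventually.of_forall hJ)
    cJ.continuousAt, fun v => ?_⟩
  have e1 : Z' θ v = ⟪G θ, v⟫ := by
    rw [hZ', hb.expInt_smulRight_apply aestronglyMeasurable_const hone, hG, real_inner_comm,
      ← innerSL_apply_apply ℝ, hb.map_expInt aestronglyMeasurable_s hb.norm_s_le]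
    simp [real_inner_comm]
  have e2 : G' θ v = M.expInt (fun x => ⟪M.s x, v⟫ • M.s x) θ :=
    hb.expInt_smulRight_apply aestronglyMeasurable_s hb.norm_s_le θ v
  rw [hb.integral_law, hb.meanMap_eq, ← e2, ← hZ, ← hG]
  simp only [J, _root_.add_apply, _root_.smul_apply, ContinuousLinearMap.smulRight_apply, e1,
    smul_smul, real_inner_smul_left, smul_eq_mul]
  rw [sub_eq_add_neg, ← neg_smul]
  congr 2
  field_simp

theorem integrable_law (hb : M.IsBounded B) {F : Type*} [NormedAddCommGroup F]
    {g : 𝒳 → F} (hg : StronglyMeasurable g) {C : ℝ} (hC : ∀ x, ‖g x‖ ≤ C)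
    (θ : EuclideanSpace ℝ (Fin d)) : Integrable g (M.law θ) :=
  have := hb.isProbabilityMeasure_law θ
  Integrable.of_bound hg.aestronglyMeasurable C (ae_of_all _ hC)

theorem norm_s_sub_meanMap_le (hb : M.IsBounded B) (θ : EuclideanSpace ℝ (Fin d)) (x : 𝒳) :
    ‖M.s x - M.meanMap θ‖ ≤ B + ‖M.meanMap θ‖ :=
  (norm_sub_le _ _).trans (by gcongr; exact hb.norm_s_le x)

theorem ae_law_h_pos (θ : EuclideanSpace ℝ (Fin d)) : ∀ᵐ x ∂(M.law θ), 0 < M.h x := by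
  have hmeas : Measurable (M.density θ) :=
    M.measurable_h.mul (((Measurable.const_inner M.measurable_s).sub_const _).exp)
  rw [law, ae_withDensity_iff hmeas.ennreal_ofReal]
  refine ae_of_all _ fun x hx => lt_of_le_of_ne (M.h_nonneg x) fun h => hx ?_
  simp [density, ← h]

/-- Where `h` vanishes the log-density is the default value `Real.log 0 = 0`; such points are null
for the law by `ae_law_h_pos`. -/
theorem score_eq (hb : M.IsBounded B) (θ : EuclideanSpace ℝ (Fin d)) {x : 𝒳} (hx : 0 < M.h x) :
    M.score θ x = M.s x - M.meanMap θ := by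
  have h1 : HasGradientAt (fun t => Real.log (M.h x) + (⟪t, M.s x⟫ - M.logPartition t))
      (M.s x - M.meanMap θ) θ := by
    have hA := hb.hasGradientAt_logPartition θ
    rw [← hb.meanMap_eq, hasGradientAt_iff_hasFDerivAt] at hA
    have hin : HasFDerivAt (fun t : EuclideanSpace ℝ (Fin d) => ⟪t, M.s x⟫)
        (innerSL ℝ (M.s x)) θ :=
      ((innerSL ℝ (M.s x)).hasFDerivAt (x := θ)).congr_of_eventuallyEq
        (Eventually.of_forall fun y => by simp [real_inner_comm])
    rw [hasGradientAt_iff_hasFDerivAt]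
    refine ((hin.sub hA).const_add (Real.log (M.h x))).congr_fderiv ?_
    ext v
    simp
  have h2 : (fun t => Real.log (M.density t x)) =
      fun t => Real.log (M.h x) + (⟪t, M.s x⟫ - M.logPartition t) := by
    ext t
    rw [density, Real.log_mul hx.ne' (Real.exp_pos _).ne', Real.log_exp]
  rw [score, h2, h1.gradient]

theorem inner_toEuclideanCLM_fisher (hb : M.IsBounded B) (θ v w : EuclideanSpace ℝ (Fin d)) :
    ⟪w, Matrix.toEuclideanCLM (𝕜 := ℝ) (M.fisher θ) v⟫ =
      ∫ x, ⟪w, M.s x - M.meanMap θ⟫ * ⟪v, M.s x - M.meanMap θ⟫ ∂(M.law θ) := by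
  set y : 𝒳 → EuclideanSpace ℝ (Fin d) := fun x => M.s x - M.meanMap θ with hy
  have hyi : ∀ i j, Integrable (fun x => y x i * y x j) (M.law θ) := by
    intro i j
    have hm : ∀ i, Measurable fun x => y x i := fun i => by
      have := M.measurable_s
      fun_prop
    refine hb.integrable_law (C := (B + ‖M.meanMap θ‖) * (B + ‖M.meanMap θ‖))
      ((hm i).mul (hm j)).stronglyMeasurable (fun x => ?_) θ
    rw [Pi.mul_apply, norm_mul]
    have h := fun i => (PiLp.norm_apply_le (y x) i).trans (hb.norm_s_sub_meanMap_le θ x)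
    exact mul_le_mul (h i) (h j) (norm_nonneg _) ((norm_nonneg _).trans (h i))
  have hF : ∀ i j, M.fisher θ i j = ∫ x, y x i * y x j ∂(M.law θ) := by
    intro i j
    refine integral_congr_ae ?_
    filter_upwards [ae_law_h_pos θ] with x hx
    rw [hb.score_eq θ hx]
  rw [Matrix.inner_toEuclideanCLM]
  have hexp : ∀ x, ⟪w, y x⟫ * ⟪v, y x⟫ = ∑ i, ∑ j, w i * v j * (y x i * y x j) := by
    intro x
    simp only [PiLp.inner_apply, RCLike.inner_apply, conj_trivial]
    rw [Finset.sum_mul_sum]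
    exact Finset.sum_congr rfl fun i _ => Finset.sum_congr rfl fun j _ => by ring
  change _ = ∫ x, ⟪w, y x⟫ * ⟪v, y x⟫ ∂_
  simp_rw [hexp]
  rw [integral_finsetSum _ fun i _ => integrable_finsetSum _ fun j _ => (hyi i j).const_mul _]
  simp only [dotProduct, Matrix.mulVec, Finset.mul_sum]
  refine Finset.sum_congr rfl fun i _ => ?_
  rw [integral_finsetSum _ fun j _ => (hyi i j).const_mul _]
  refine Finset.sum_congr rfl fun j _ => ?_
  rw [integral_const_mul, hF]
  ring

/-- The information identity: the Hessian of `A` and the second moment of the score are both the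
covariance of `s`. -/
theorem hasStrictFDerivAt_meanMap (hb : M.IsBounded B) (θ : EuclideanSpace ℝ (Fin d)) :
    HasStrictFDerivAt M.meanMap (Matrix.toEuclideanCLM (𝕜 := ℝ) (M.fisher θ)) θ := by
  obtain ⟨J, hJ, hJv⟩ := hb.exists_hasStrictFDerivAt_meanMap θ
  have := hb.isProbabilityMeasure_law θ
  convert hJ using 1
  ext1 v
  refine ext_inner_left ℝ fun w => ?_
  rw [hb.inner_toEuclideanCLM_fisher, hJv, inner_sub_right, real_inner_smul_right]
  have hm := hb.meanMap_eq_integral θ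
  have hsm := M.measurable_s
  have is : Integrable M.s (M.law θ) := hb.integrable_law hsm.stronglyMeasurable hb.norm_s_le θ
  have iss : Integrable (fun x => ⟪M.s x, v⟫ • M.s x) (M.law θ) := by
    refine hb.integrable_law (C := B * ‖v‖ * B) ?_ (fun x => ?_) θ
    · exact Measurable.stronglyMeasurable (by fun_prop)
    · rw [norm_smul]
      have h1 : ‖⟪M.s x, v⟫‖ ≤ B * ‖v‖ := (norm_inner_le_norm _ _).trans
        (mul_le_mul_of_nonneg_right (hb.norm_s_le x) (norm_nonneg v))
      exact mul_le_mul h1 (hb.norm_s_le x) (norm_nonneg _) ((norm_nonneg _).trans h1)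
  rw [← integral_inner iss]
  have iww := is.const_inner (𝕜 := ℝ) w
  have ivv := is.const_inner (𝕜 := ℝ) v
  have iwv := iss.const_inner (𝕜 := ℝ) w
  set m := M.meanMap θ
  have hwi : ∫ x, ⟪w, M.s x⟫ ∂(M.law θ) = ⟪w, m⟫ := by rw [hm, ← integral_inner is]
  have hvi : ∫ x, ⟪v, M.s x⟫ ∂(M.law θ) = ⟪v, m⟫ := by rw [hm, ← integral_inner is]
  have hexp : ∀ x, ⟪w, M.s x - m⟫ * ⟪v, M.s x - m⟫ =
      ⟪w, ⟪M.s x, v⟫ • M.s x⟫ - ⟪v, m⟫ * ⟪w, M.s x⟫ - ⟪w, m⟫ * ⟪v, M.s x⟫ + ⟪w, m⟫ * ⟪v, m⟫ := by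
    intro x
    rw [inner_sub_right, inner_sub_right, real_inner_smul_right, real_inner_comm v (M.s x)]
    ring
  simp_rw [hexp]
  have i1 : Integrable (fun x => ⟪w, ⟪M.s x, v⟫ • M.s x⟫ - ⟪v, m⟫ * ⟪w, M.s x⟫) (M.law θ) :=
    iwv.sub (iww.const_mul _)
  have i2 : Integrable (fun x => ⟪w, ⟪M.s x, v⟫ • M.s x⟫ - ⟪v, m⟫ * ⟪w, M.s x⟫ -
      ⟪w, m⟫ * ⟪v, M.s x⟫) (M.law θ) := i1.sub (ivv.const_mul _)
  rw [integral_add i2 (integrable_const _),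
    integral_sub i1 (ivv.const_mul _),
    integral_sub iwv (iww.const_mul _), integral_const_mul, integral_const_mul, hwi, hvi,
    integral_const]
  simp [real_inner_comm]

/-! The strict tangent inequality for the log-partition function and its consequences. -/

/-- Integrate `e^y - 1 - y ≥ 0` at `y = ⟪u, s⟫ - c` against the weight at `θ₁`, where `c` is the
mean of `⟪u, s⟫`: the linear term drops out and `e^(-c) Z(θ₂) - Z(θ₁)` remains. If it were 0, then
`⟪u, s⟫ = c` almost everywhere, against minimality. -/
theorem logPartition_gt_tangent (hb : M.IsBounded B) (hM : M.IsMinimalRegular)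
    {θ₁ θ₂ : EuclideanSpace ℝ (Fin d)} (hne : θ₁ ≠ θ₂) :
    M.logPartition θ₁ + ⟪θ₂ - θ₁, M.meanMap θ₁⟫ < M.logPartition θ₂ := by
  set u := θ₂ - θ₁ with hu
  set c := ⟪u, M.meanMap θ₁⟫ with hc
  set Z := M.expInt (fun _ => (1 : ℝ)) with hZ
  have hZ1 := hb.expInt_one_pos θ₁
  have hone : ∀ x : 𝒳, ‖(1 : ℝ)‖ ≤ 1 := by simp
  set f : 𝒳 → ℝ := fun x => (M.h x * Real.exp ⟪θ₁, M.s x⟫) *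
    (Real.exp (⟪u, M.s x⟫ - c) - 1 - (⟪u, M.s x⟫ - c)) with hf
  have hfnn : ∀ x, 0 ≤ f x := fun x => mul_nonneg (weight_nonneg θ₁ x) (by
    linarith [Real.add_one_le_exp (⟪u, M.s x⟫ - c)])
  have i0 := hb.integrable_weight θ₁
  have i2 := hb.integrable_weight θ₂
  have i1 : Integrable (fun x => (M.h x * Real.exp ⟪θ₁, M.s x⟫) * ⟪u, M.s x⟫) M.base := by
    have := (hb.integrable_weight_smul aestronglyMeasurable_s hb.norm_s_le θ₁).const_inner (𝕜 := ℝ) u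
    simpa [real_inner_smul_right] using this
  have hfe : f = fun x => Real.exp (-c) * (M.h x * Real.exp ⟪θ₂, M.s x⟫) -
      (1 - c) * (M.h x * Real.exp ⟪θ₁, M.s x⟫) -
      (M.h x * Real.exp ⟪θ₁, M.s x⟫) * ⟪u, M.s x⟫ := by
    ext x
    have : ⟪θ₂, M.s x⟫ = ⟪θ₁, M.s x⟫ + ⟪u, M.s x⟫ := by rw [hu, inner_sub_left]; ring
    simp only [hf]
    rw [this, Real.exp_add, Real.exp_sub, Real.exp_neg]
    ring
  have i3 : Integrable (fun x => Real.exp (-c) * (M.h x * Real.exp ⟪θ₂, M.s x⟫) -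
      (1 - c) * (M.h x * Real.exp ⟪θ₁, M.s x⟫)) M.base := (i2.const_mul _).sub (i0.const_mul _)
  have fi : Integrable f M.base := by
    rw [hfe]; exact i3.sub i1
  have hZeq : ∀ t, Z t = ∫ x, M.h x * Real.exp ⟪t, M.s x⟫ ∂M.base := fun t => by
    simp [hZ, expInt]
  have hGeq : ∫ x, (M.h x * Real.exp ⟪θ₁, M.s x⟫) * ⟪u, M.s x⟫ ∂M.base = c * Z θ₁ := by
    have h1 := hb.map_expInt aestronglyMeasurable_s hb.norm_s_le θ₁ (innerSL ℝ u)
    rw [innerSL_apply_apply] at h1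
    rw [hc, hb.meanMap_eq, real_inner_smul_right, h1, ← hZ, mul_comm, ← mul_assoc,
      mul_inv_cancel₀ hZ1.ne', one_mul]
    simp [expInt]
  have hint : ∫ x, f x ∂M.base = Real.exp (-c) * Z θ₂ - Z θ₁ := by
    rw [hfe, integral_sub i3 i1,
      integral_sub (i2.const_mul _) (i0.const_mul _), integral_const_mul, integral_const_mul,
      ← hZeq, ← hZeq, hGeq]
    ring
  have hpos : 0 < ∫ x, f x ∂M.base := by
    refine lt_of_le_of_ne (integral_nonneg hfnn) fun h0 => hne ?_
    have hae := (integral_eq_zero_iff_of_nonneg hfnn fi).1 h0.symm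
    have : u = 0 := by
      refine hM.minimal u c ?_
      rw [ae_withDensity_iff M.measurable_h.ennreal_ofReal]
      filter_upwards [hae] with x hx hhx
      have hh : M.h x ≠ 0 := fun h => hhx (by simp [h])
      by_contra hcon
      have := Real.add_one_lt_exp (sub_ne_zero.2 hcon)
      have h2 : Real.exp (⟪u, M.s x⟫ - c) - 1 - (⟪u, M.s x⟫ - c) = 0 :=
        (mul_eq_zero.1 hx).resolve_left (mul_ne_zero hh (Real.exp_pos _).ne')
      linarith
    exact (sub_eq_zero.1 this).symm
  rw [hint] at hpos
  rw [← Real.exp_lt_exp, Real.exp_add, hb.exp_logPartition, hb.exp_logPartition]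
  rw [Real.exp_neg] at hpos
  have := mul_lt_mul_of_pos_left (sub_pos.1 hpos) (Real.exp_pos c)
  rw [← mul_assoc, mul_inv_cancel₀ (Real.exp_pos c).ne', one_mul] at this
  linarith

theorem meanMap_injective (hb : M.IsBounded B) (hM : M.IsMinimalRegular) :
    Function.Injective M.meanMap := by
  intro θ₁ θ₂ h
  by_contra hne
  have h1 := hb.logPartition_gt_tangent hM hne
  have h2 := hb.logPartition_gt_tangent hM (Ne.symm hne)
  rw [h, ← neg_sub θ₁ θ₂, inner_neg_left] at h1
  linarith

/-- The likelihood is `∏ h · exp(n (⟪t, S̄⟫ - A(t)))`, and the strict tangent inequality at a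
solution of `∇A(θ) = S̄` makes it the only maximizer. Were some `h (D i)` zero, the likelihood would
vanish identically. -/
theorem mleSet_eq_singleton (hb : M.IsBounded B) (hM : M.IsMinimalRegular)
    {Θ : Set (EuclideanSpace ℝ (Fin d))} {n : ℕ} (hn : 0 < n) {D : Fin n → 𝒳}
    (hD : ∀ i, 0 < M.h (D i)) {θ : EuclideanSpace ℝ (Fin d)} (hθ : θ ∈ Θ)
    (hmean : M.meanMap θ = M.empStat D) : M.mleSet Θ D = {θ} := by
  have hn' : (0 : ℝ) < n := by exact_mod_cast hn
  have hlik : ∀ t, ∏ i, M.density t (D i) =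
      (∏ i, M.h (D i)) * Real.exp (n * (⟪t, M.empStat D⟫ - M.logPartition t)) := by
    intro t
    simp only [density]
    rw [Finset.prod_mul_distrib, ← Real.exp_sum, Finset.sum_sub_distrib, ← inner_sum]
    congr 2
    rw [empStat, real_inner_smul_right]
    simp
    field_simp
  have hprod : 0 < ∏ i, M.h (D i) := Finset.prod_pos fun i _ => hD i
  have hlt : ∀ t, t ≠ θ → ∏ i, M.density t (D i) < ∏ i, M.density θ (D i) := by
    intro t ht
    rw [hlik, hlik]
    have h1 := hb.logPartition_gt_tangent hM (Ne.symm ht)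
    rw [hmean, inner_sub_left] at h1
    refine mul_lt_mul_of_pos_left (Real.exp_lt_exp.2 (mul_lt_mul_of_pos_left ?_ hn')) hprod
    linarith
  ext t
  refine ⟨fun ht => ?_, ?_⟩
  · by_contra hne
    exact absurd (isMaxOn_iff.1 ht.2 θ hθ) (not_le.2 (hlt t hne))
  · rintro rfl
    refine ⟨hθ, isMaxOn_iff.2 fun t' _ => ?_⟩
    rcases eq_or_ne t' t with rfl | hne
    · exact le_rfl
    · exact (hlt t' hne).le

theorem plugInSet_eq_singleton (hb : M.IsBounded B) (hM : M.IsMinimalRegular)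
    {Θ : Set (EuclideanSpace ℝ (Fin d))} {θ : EuclideanSpace ℝ (Fin d)} (hθ : θ ∈ Θ) :
    M.plugInSet Θ (M.meanMap θ) = {θ} := by
  ext t
  refine ⟨fun ht => hb.meanMap_injective hM ht.2, ?_⟩
  rintro rfl
  exact ⟨hθ, rfl⟩

end IsBounded

end ExpFamily

/-! ### A quantitative central limit theorem for bounded vectors, with Gaussian noise -/

theorem norm_pow_sub_pow_le_mul {a b : ℂ} (ha : ‖a‖ ≤ 1) (hb : ‖b‖ ≤ 1) (n : ℕ) :
    ‖a ^ n - b ^ n‖ ≤ n * ‖a - b‖ := by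
  induction n with
  | zero => simp
  | succ n ih =>
    have : a ^ (n + 1) - b ^ (n + 1) = a * (a ^ n - b ^ n) + (a - b) * b ^ n := by ring
    rw [this]
    calc _ ≤ ‖a‖ * ‖a ^ n - b ^ n‖ + ‖a - b‖ * ‖b‖ ^ n := by
          refine (norm_add_le _ _).trans ?_
          rw [norm_mul, norm_mul, norm_pow]
      _ ≤ 1 * (n * ‖a - b‖) + ‖a - b‖ * 1 := by
          gcongr
          exact pow_le_one₀ (norm_nonneg _) hb
      _ = _ := by push_cast; ring

section CharFun

variable {E : Type*} [NormedAddCommGroup E] [InnerProductSpace ℝ E] [MeasurableSpace E]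
  [BorelSpace E] [SecondCountableTopology E] [CompleteSpace E]

/-- The second order expansion of the characteristic function of a bounded centered law. -/
theorem norm_charFun_sub_exp_le {ρ : Measure E} [IsProbabilityMeasure ρ] {C : ℝ} (hC : 0 ≤ C)
    (hρ : ∀ᵐ y ∂ρ, ‖y‖ ≤ C) (h0 : ∫ y, y ∂ρ = 0) {t : E} (ht : C * ‖t‖ ≤ 1) :
    ‖charFun ρ t - ((Real.exp (-(∫ y, ⟪t, y⟫ ^ 2 ∂ρ) / 2) : ℝ) : ℂ)‖ ≤ 2 * (C * ‖t‖) ^ 3 := by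
  set a := C * ‖t‖ with ha
  have ha0 : 0 ≤ a := by positivity
  have hin : ∀ᵐ y ∂ρ, |⟪y, t⟫| ≤ a := by
    filter_upwards [hρ] with y hy
    exact (abs_real_inner_le_norm _ _).trans (mul_le_mul_of_nonneg_right hy (norm_nonneg t))
  set q := ∫ y, ⟪t, y⟫ ^ 2 ∂ρ with hq
  have hid : Integrable (fun y : E => y) ρ :=
    Integrable.of_bound aestronglyMeasurable_id C hρ
  have i1 : Integrable (fun y => ⟪y, t⟫) ρ := hid.inner_const t
  have i2 : Integrable (fun y => ⟪y, t⟫ ^ 2) ρ := by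
    refine Integrable.of_bound (by fun_prop) (a ^ 2) ?_
    filter_upwards [hin] with y hy
    rw [Real.norm_eq_abs, abs_pow]
    gcongr
  have ie : Integrable (fun y => Complex.exp (⟪y, t⟫ * Complex.I)) ρ := by
    refine Integrable.of_bound (by fun_prop) 1 (ae_of_all _ fun y => ?_)
    rw [Complex.norm_exp_ofReal_mul_I]
  have hqa : q ≤ a ^ 2 := by
    calc q ≤ ∫ _, a ^ 2 ∂ρ := by
          refine integral_mono_ae (by simpa [real_inner_comm] using i2) (integrable_const _) ?_
          filter_upwards [hin] with y hy
          rw [real_inner_comm]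
          exact (sq_abs ⟪y, t⟫).symm.le.trans (by gcongr)
      _ = a ^ 2 := by simp
  have hq0 : 0 ≤ q := integral_nonneg fun y => sq_nonneg _
  have hm : ∫ y, ⟪y, t⟫ ∂ρ = 0 := by
    have := integral_inner (𝕜 := ℝ) hid t
    rw [h0, inner_zero_right] at this
    rw [← this]
    exact integral_congr_ae (ae_of_all _ fun y => real_inner_comm _ _)
  have j1 : Integrable (fun y => (⟪y, t⟫ : ℂ) * Complex.I) ρ := i1.ofReal.mul_const _
  have j2 : Integrable (fun y => (⟪y, t⟫ : ℂ) ^ 2 / 2) ρ := by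
    have := i2.ofReal (𝕜 := ℂ)
    simp only [Complex.coe_algebraMap, RCLike.ofReal_pow] at this
    exact this.div_const 2
  have j3 : Integrable (fun y => 1 + (⟪y, t⟫ : ℂ) * Complex.I) ρ := (integrable_const _).add j1
  have hpoly : ∫ y, (1 + (⟪y, t⟫ : ℂ) * Complex.I - (⟪y, t⟫ : ℂ) ^ 2 / 2) ∂ρ =
      ((1 - q / 2 : ℝ) : ℂ) := by
    rw [integral_sub j3 j2, integral_add (integrable_const _) j1, integral_mul_const,
      integral_div, integral_complex_ofReal, hm]
    have : ∫ y, (⟪y, t⟫ : ℂ) ^ 2 ∂ρ = ((q : ℝ) : ℂ) := by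
      rw [hq, ← integral_complex_ofReal]
      refine integral_congr_ae (ae_of_all _ fun y => ?_)
      simp [real_inner_comm]
    rw [this]
    simp
  -- Third-order Taylor remainder of `exp(i⟪y, t⟫)`, integrated; the linear term vanishes by
  -- centering.
  have h1 : ‖charFun ρ t - ((1 - q / 2 : ℝ) : ℂ)‖ ≤ a ^ 3 := by
    rw [charFun_apply, ← hpoly, ← integral_sub ie]
    · calc _ ≤ ∫ _, a ^ 3 ∂ρ := by
            refine norm_integral_le_of_norm_le (integrable_const _) ?_
            filter_upwards [hin] with y hy
            have hn : ‖(⟪y, t⟫ : ℂ) * Complex.I‖ = |⟪y, t⟫| := by simp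
            have := Complex.exp_bound (x := (⟪y, t⟫ : ℂ) * Complex.I) (by rw [hn]; linarith)
              (n := 3) (by norm_num)
            simp only [Finset.sum_range_succ, Finset.sum_range_zero] at this
            have e : (1 + (⟪y, t⟫ : ℂ) * Complex.I - (⟪y, t⟫ : ℂ) ^ 2 / 2) =
                0 + ((⟪y, t⟫ : ℂ) * Complex.I) ^ 0 / ((Nat.factorial 0 : ℕ) : ℂ) +
                ((⟪y, t⟫ : ℂ) * Complex.I) ^ 1 / ((Nat.factorial 1 : ℕ) : ℂ) +
                ((⟪y, t⟫ : ℂ) * Complex.I) ^ 2 / ((Nat.factorial 2 : ℕ) : ℂ) := by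
              simp [mul_pow, Nat.factorial]
              ring
            rw [e]
            refine this.trans ?_
            rw [hn]
            calc |⟪y, t⟫| ^ 3 * _ ≤ a ^ 3 * 1 := by
                  gcongr
                  norm_num [Nat.factorial]
              _ = a ^ 3 := mul_one _
        _ = a ^ 3 := by simp
    · exact j3.sub j2
  -- The error is at most `(q/2)² ≤ a⁴/4`, and `a ≤ 1`.
  have h2 : ‖((1 - q / 2 : ℝ) : ℂ) - ((Real.exp (-q / 2) : ℝ) : ℂ)‖ ≤ a ^ 3 := by
    rw [← Complex.ofReal_sub, Complex.norm_real, Real.norm_eq_abs, abs_sub_comm]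
    have hx : |-q / 2| ≤ 1 := by
      rw [neg_div, abs_neg, abs_of_nonneg (by positivity)]
      nlinarith
    have := Real.abs_exp_sub_one_sub_id_le hx
    rw [show Real.exp (-q / 2) - (1 - q / 2) = Real.exp (-q / 2) - 1 - -q / 2 by ring]
    refine this.trans ?_
    have : q ^ 2 ≤ (a ^ 2) ^ 2 := by gcongr
    have h4 : a ^ 3 * a ≤ a ^ 3 * 1 := by gcongr
    nlinarith [pow_nonneg ha0 3]
  calc _ = ‖(charFun ρ t - ((1 - q / 2 : ℝ) : ℂ)) +
        (((1 - q / 2 : ℝ) : ℂ) - ((Real.exp (-q / 2) : ℝ) : ℂ))‖ := by rw [sub_add_sub_cancel]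
    _ ≤ _ := (norm_add_le _ _).trans (by linarith)

end CharFun

theorem charFun_map_clm {E Ω : Type*} [NormedAddCommGroup E] [InnerProductSpace ℝ E]
    [CompleteSpace E] [MeasurableSpace E] [BorelSpace E] [SecondCountableTopology E]
    [MeasurableSpace Ω] {P : Measure Ω} {U : Ω → E} (hU : AEMeasurable U P) (L : E →L[ℝ] E) (t : E) :
    charFun (P.map fun ω => L (U ω)) t = charFun (P.map U) (L.adjoint t) := by
  have hLU : AEMeasurable (fun ω => L (U ω)) P := L.continuous.measurable.comp_aemeasurable hU
  rw [charFun_apply, charFun_apply, integral_map hU (by fun_prop), integral_map hLU (by fun_prop)]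
  simp_rw [ContinuousLinearMap.adjoint_inner_right]

namespace ExpFamily

variable {𝒳 : Type*} [MeasurableSpace 𝒳] {d : ℕ} {M : ExpFamily 𝒳 d} {B : ℝ}
  {Ω : Type*} [MeasurableSpace Ω]

/-- The noisy empirical statistic of the first `n` observations. -/
def noisyStat (M : ExpFamily 𝒳 d) (X : ℕ → Ω → 𝒳) (Z : ℕ → Ω → EuclideanSpace ℝ (Fin d)) (n : ℕ)
    (ω : Ω) : EuclideanSpace ℝ (Fin d) :=
  M.empStat (fun i : Fin n => X i ω) + Z n ω

/-- Independent observations from `M.law θ₀`, and independent isotropic Gaussian noise. -/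
structure NoisySample (M : ExpFamily 𝒳 d) (θ₀ : EuclideanSpace ℝ (Fin d)) (σ : ℕ → ℝ)
    (P : Measure Ω) (X : ℕ → Ω → 𝒳) (Z : ℕ → Ω → EuclideanSpace ℝ (Fin d)) : Prop where
  hasLaw_obs : ∀ i, HasLaw (X i) (M.law θ₀) P
  indep_obs : iIndepFun X P
  hasLaw_noise : ∀ n, HasLaw (Z n) (isoGaussian 0 (σ n)) P
  indep_noise : ∀ n, IndepFun (Z n) (fun ω (i : Fin n) => X i ω) P

theorem measurable_empStat (M : ExpFamily 𝒳 d) (n : ℕ) :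
    Measurable (fun D : Fin n → 𝒳 => M.empStat D) := by
  have := M.measurable_s
  unfold empStat
  fun_prop

/-- The law of the centered sufficient statistic. -/
def centeredLaw (M : ExpFamily 𝒳 d) (θ : EuclideanSpace ℝ (Fin d)) :
    Measure (EuclideanSpace ℝ (Fin d)) :=
  (M.law θ).map fun x => M.s x - M.meanMap θ

theorem measurable_s_sub (M : ExpFamily 𝒳 d) (m : EuclideanSpace ℝ (Fin d)) :
    Measurable fun x => M.s x - m :=
  M.measurable_s.sub_const m

namespace IsBounded

theorem isProbabilityMeasure_centeredLaw (hb : M.IsBounded B) (θ : EuclideanSpace ℝ (Fin d)) :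
    IsProbabilityMeasure (M.centeredLaw θ) :=
  have := hb.isProbabilityMeasure_law θ
  Measure.isProbabilityMeasure_map (M.measurable_s_sub _).aemeasurable

theorem norm_charFun_centeredLaw_sub_le (hb : M.IsBounded B) (θ : EuclideanSpace ℝ (Fin d))
    {t : EuclideanSpace ℝ (Fin d)} (ht : (B + ‖M.meanMap θ‖) * ‖t‖ ≤ 1) :
    ‖charFun (M.centeredLaw θ) t -
      ((Real.exp (-⟪t, Matrix.toEuclideanCLM (𝕜 := ℝ) (M.fisher θ) t⟫ / 2) : ℝ) : ℂ)‖ ≤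
      2 * ((B + ‖M.meanMap θ‖) * ‖t‖) ^ 3 := by
  have := hb.isProbabilityMeasure_centeredLaw θ
  have := hb.isProbabilityMeasure_law θ
  have hm := M.measurable_s_sub (M.meanMap θ)
  have h1 := norm_charFun_sub_exp_le (ρ := M.centeredLaw θ)
    (add_nonneg hb.nonneg_bound (norm_nonneg (M.meanMap θ))) ?_ ?_ ht
  · convert h1 using 5
    rw [hb.inner_toEuclideanCLM_fisher, centeredLaw, integral_map hm.aemeasurable (by fun_prop)]
    simp_rw [sq]
  · rw [centeredLaw, ae_map_iff hm.aemeasurable (by measurability)]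
    exact ae_of_all _ fun x => hb.norm_s_sub_meanMap_le θ x
  · rw [centeredLaw, integral_map hm.aemeasurable (by fun_prop), integral_sub
      (hb.integrable_law M.measurable_s.stronglyMeasurable hb.norm_s_le θ) (integrable_const _),
      ← hb.meanMap_eq_integral]
    simp

end IsBounded

namespace NoisySample

variable {θ₀ : EuclideanSpace ℝ (Fin d)} {σ : ℕ → ℝ} {P : Measure Ω}
  {X : ℕ → Ω → 𝒳} {Z : ℕ → Ω → EuclideanSpace ℝ (Fin d)}

theorem aemeasurable_obs (hS : NoisySample M θ₀ σ P X Z) (n : ℕ) :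
    AEMeasurable (fun ω (i : Fin n) => X i ω) P :=
  aemeasurable_pi_lambda _ fun i => (hS.hasLaw_obs i).aemeasurable

theorem aemeasurable_noisyStat (hS : NoisySample M θ₀ σ P X Z) (n : ℕ) :
    AEMeasurable (M.noisyStat X Z n) P :=
  ((M.measurable_empStat n).comp_aemeasurable (hS.aemeasurable_obs n)).add
    (hS.hasLaw_noise n).aemeasurable

variable [IsProbabilityMeasure P]

/-- By independence, `√n (S̃ - m)` splits into `n^(-1/2)` times a sum of `n` i.i.d. centered terms
and the noise `√n Z`. The noise factor is exact, so no bound on `n σ²` is involved. -/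
theorem charFun_noisyStat (hb : M.IsBounded B) (hS : NoisySample M θ₀ σ P X Z) {n : ℕ}
    (hn : 0 < n) (t : EuclideanSpace ℝ (Fin d)) :
    charFun (P.map fun ω => √(n : ℝ) • (M.noisyStat X Z n ω - M.meanMap θ₀)) t =
      charFun (M.centeredLaw θ₀) ((√(n : ℝ))⁻¹ • t) ^ n *
        ((Real.exp (-(n * σ n ^ 2 * ‖t‖ ^ 2) / 2) : ℝ) : ℂ) := by
  have := hb.isProbabilityMeasure_law θ₀
  have hn' : (0 : ℝ) < n := by exact_mod_cast hn
  have hs : √(n : ℝ) ≠ 0 := (Real.sqrt_pos.2 hn').ne'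
  set m := M.meanMap θ₀
  set Y : ℕ → Ω → EuclideanSpace ℝ (Fin d) := fun i ω => M.s (X i ω) - m with hY
  have hlaw : HasLaw (fun x => M.s x - m) (M.centeredLaw θ₀) (M.law θ₀) :=
    ⟨(M.measurable_s_sub m).aemeasurable, rfl⟩
  have hYlaw : ∀ i, HasLaw (Y i) (M.centeredLaw θ₀) P := fun i => hlaw.comp (hS.hasLaw_obs i)
  have hYind : iIndepFun Y P := hS.indep_obs.comp _ fun _ => M.measurable_s_sub m
  set G : (Fin n → 𝒳) → EuclideanSpace ℝ (Fin d) := fun D => √(n : ℝ) • (M.empStat D - m) with hG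
  have hGm : Measurable G := ((M.measurable_empStat n).sub_const m).const_smul √(n : ℝ)
  have hGY : ∀ ω, G (fun i : Fin n => X i ω) = (√(n : ℝ))⁻¹ • ∑ i ∈ Finset.range n, Y i ω := by
    intro ω
    have h1 : ∑ i ∈ Finset.range n, Y i ω = ∑ i : Fin n, M.s (X i ω) - (n : ℝ) • m := by
      rw [hY, Finset.sum_sub_distrib, Finset.sum_const, Finset.card_range,
        ← Fin.sum_univ_eq_sum_range (fun i => M.s (X i ω)) n, Nat.cast_smul_eq_nsmul]
    have h2 : √(n : ℝ) * (n : ℝ)⁻¹ = (√(n : ℝ))⁻¹ := by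
      nth_rewrite 2 [← Real.mul_self_sqrt hn'.le]
      field_simp
    have h3 : (√(n : ℝ))⁻¹ * n = √(n : ℝ) := by
      nth_rewrite 2 [← Real.mul_self_sqrt hn'.le]
      field_simp
    rw [h1, hG]
    simp only [empStat]
    rw [smul_sub, smul_smul, h2, smul_sub, smul_smul, h3]
  have hind : IndepFun (fun ω => G fun i : Fin n => X i ω) (fun ω => √(n : ℝ) • Z n ω) P :=
    (hS.indep_noise n).symm.comp hGm (measurable_const_smul √(n : ℝ))
  have hdec : (fun ω => √(n : ℝ) • (M.noisyStat X Z n ω - m)) =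
      (fun ω => G fun i : Fin n => X i ω) + (fun ω => √(n : ℝ) • Z n ω) := by
    ext1 ω
    simp only [noisyStat, hG, Pi.add_apply, smul_sub, smul_add]
    abel
  have hGX : AEMeasurable (fun ω => G fun i : Fin n => X i ω) P :=
    hGm.comp_aemeasurable (hS.aemeasurable_obs n)
  have hZm : AEMeasurable (fun ω => √(n : ℝ) • Z n ω) P :=
    (hS.hasLaw_noise n).aemeasurable.const_smul √(n : ℝ)
  rw [hdec, hind.charFun_map_add_eq_mul hGX hZm, Pi.mul_apply]
  congr 1
  · simp_rw [hGY]
    rw [charFun_map_smul_comp (by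
      exact Finset.aemeasurable_fun_sum _ fun i _ => (hYlaw i).aemeasurable),
      iIndepFun.charFun_map_fun_finsetSum_eq_prod (fun i _ => (hYlaw i).aemeasurable)
        (hYind.restrict _)]
    simp [(hYlaw _).map_eq]
  · rw [charFun_map_smul_comp (hS.hasLaw_noise n).aemeasurable, (hS.hasLaw_noise n).map_eq,
      isoGaussian, charFun_multivariateGaussian (posSemidef_sq_smul_one _), Complex.ofReal_exp]
    congr 1
    have h1 : ∀ y : EuclideanSpace ℝ (Fin d),
        (y.ofLp ⬝ᵥ ((σ n) ^ 2 • (1 : Matrix (Fin d) (Fin d) ℝ)).mulVec y.ofLp) = σ n ^ 2 * ‖y‖ ^ 2 := by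
      intro y
      rw [Matrix.smul_mulVec, Matrix.one_mulVec, dotProduct_smul, EuclideanSpace.real_norm_sq_eq,
        smul_eq_mul, dotProduct]
      simp [sq]
    rw [h1, norm_smul, mul_pow, Real.norm_eq_abs, sq_abs, Real.sq_sqrt hn'.le, inner_zero_right]
    push_cast
    ring

/-- Each of the `n` factors costs `2 (C‖t‖/√n)³`, and the noise factor has modulus at most 1. The
bound is uniform in `σ` and in bounded `t`, which permits operators varying with `n` and divergent
`n σ²`. -/
theorem norm_charFun_noisyStat_sub_le (hb : M.IsBounded B) (hS : NoisySample M θ₀ σ P X Z) {n : ℕ}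
    (hn : 0 < n) {t : EuclideanSpace ℝ (Fin d)} (ht : (B + ‖M.meanMap θ₀‖) * ‖t‖ ≤ √(n : ℝ)) :
    ‖charFun (P.map fun ω => √(n : ℝ) • (M.noisyStat X Z n ω - M.meanMap θ₀)) t -
      ((Real.exp (-(⟪t, Matrix.toEuclideanCLM (𝕜 := ℝ) (M.fisher θ₀) t⟫ +
        n * σ n ^ 2 * ‖t‖ ^ 2) / 2) : ℝ) : ℂ)‖ ≤
      2 * ((B + ‖M.meanMap θ₀‖) * ‖t‖) ^ 3 / √(n : ℝ) := by
  have := hb.isProbabilityMeasure_centeredLaw θ₀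
  have hn' : (0 : ℝ) < n := by exact_mod_cast hn
  have hs : 0 < √(n : ℝ) := Real.sqrt_pos.2 hn'
  set C := B + ‖M.meanMap θ₀‖ with hC
  have hC0 : 0 ≤ C := add_nonneg hb.nonneg_bound (norm_nonneg _)
  set u := (√(n : ℝ))⁻¹ • t with hu
  set I := Matrix.toEuclideanCLM (𝕜 := ℝ) (M.fisher θ₀)
  have hun : C * ‖u‖ = C * ‖t‖ / √(n : ℝ) := by
    rw [hu, norm_smul, Real.norm_eq_abs, abs_of_pos (by positivity)]
    ring
  have hq0 : ∀ v, 0 ≤ ⟪v, I v⟫ := fun v => by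
    rw [hb.inner_toEuclideanCLM_fisher]
    exact integral_nonneg fun x => mul_self_nonneg _
  have hq : n * ⟪u, I u⟫ = ⟪t, I t⟫ := by
    rw [hu, map_smul, real_inner_smul_left, real_inner_smul_right, ← mul_assoc, ← mul_assoc]
    have : (n : ℝ) * (√(n : ℝ))⁻¹ * (√(n : ℝ))⁻¹ = 1 := by
      nth_rewrite 1 [← Real.mul_self_sqrt hn'.le]
      field_simp
    rw [this, one_mul]
  set b : ℂ := ((Real.exp (-⟪u, I u⟫ / 2) : ℝ) : ℂ) with hbdef
  set e : ℂ := ((Real.exp (-(n * σ n ^ 2 * ‖t‖ ^ 2) / 2) : ℝ) : ℂ) with he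
  have hb1 : ‖b‖ ≤ 1 := by
    rw [hbdef, Complex.norm_real, Real.norm_eq_abs, abs_of_pos (Real.exp_pos _)]
    exact Real.exp_le_one_iff.2 (by linarith [hq0 u])
  have he1 : ‖e‖ ≤ 1 := by
    rw [he, Complex.norm_real, Real.norm_eq_abs, abs_of_pos (Real.exp_pos _)]
    refine Real.exp_le_one_iff.2 ?_
    have : 0 ≤ n * σ n ^ 2 * ‖t‖ ^ 2 := by positivity
    linarith
  have hexp : ((Real.exp (-(⟪t, I t⟫ + n * σ n ^ 2 * ‖t‖ ^ 2) / 2) : ℝ) : ℂ) = b ^ n * e := by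
    rw [hbdef, he, ← Complex.ofReal_pow, ← Complex.ofReal_mul, ← Real.exp_nat_mul, ← Real.exp_add,
      ← hq]
    congr 2
    ring
  rw [hS.charFun_noisyStat hb hn, hexp, ← sub_mul, norm_mul]
  have h1 := norm_pow_sub_pow_le_mul (norm_charFun_le_one (μ := M.centeredLaw θ₀) u) hb1 n
  have h2 := hb.norm_charFun_centeredLaw_sub_le θ₀ (t := u)
    (by rw [hun, div_le_one hs]; exact ht)
  calc ‖charFun (M.centeredLaw θ₀) u ^ n - b ^ n‖ * ‖e‖
      ≤ (n * (2 * (C * ‖u‖) ^ 3)) * 1 :=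
        mul_le_mul (h1.trans (by gcongr)) he1 (norm_nonneg _) (by positivity)
    _ = _ := by
        rw [hun]
        nth_rewrite 1 [← Real.mul_self_sqrt hn'.le]
        field_simp

/-- Lévy's continuity theorem: the characteristic function of `L n W` at `t` is that of `W` at the
adjoint image of `t`, which stays bounded by `hL`; the previous estimate applies there. -/
theorem tendstoInDistribution_noisyStat (hb : M.IsBounded B) (hS : NoisySample M θ₀ σ P X Z)
    (L : ℕ → EuclideanSpace ℝ (Fin d) →L[ℝ] EuclideanSpace ℝ (Fin d))
    {V : Matrix (Fin d) (Fin d) ℝ} (hV : V.PosSemidef)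
    (hL : ∀ t, ∃ R, ∀ᶠ n in atTop, ‖(L n).adjoint t‖ ≤ R)
    (hlim : ∀ t, Tendsto (fun n : ℕ => ⟪(L n).adjoint t,
      Matrix.toEuclideanCLM (𝕜 := ℝ) (M.fisher θ₀) ((L n).adjoint t)⟫ +
        n * σ n ^ 2 * ‖(L n).adjoint t‖ ^ 2) atTop
      (𝓝 ⟪t, Matrix.toEuclideanCLM (𝕜 := ℝ) V t⟫)) :
    TendstoInDistribution (fun (n : ℕ) ω => L n (√(n : ℝ) • (M.noisyStat X Z n ω - M.meanMap θ₀)))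
      atTop id (fun _ => P) (multivariateGaussian 0 V) := by
  have hmeas : ∀ n : ℕ, AEMeasurable
      (fun ω => √(n : ℝ) • (M.noisyStat X Z n ω - M.meanMap θ₀)) P :=
    fun n => ((hS.aemeasurable_noisyStat n).sub_const (M.meanMap θ₀)).const_smul √(n : ℝ)
  refine ⟨fun n => (L n).continuous.measurable.comp_aemeasurable (hmeas n), aemeasurable_id, ?_⟩
  refine ProbabilityMeasure.tendsto_iff_tendsto_charFun.2 fun t => ?_
  change Tendsto (fun n : ℕ => charFun (P.map fun ω =>
    L n (√(n : ℝ) • (M.noisyStat X Z n ω - M.meanMap θ₀))) t) atTop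
    (𝓝 (charFun ((multivariateGaussian 0 V).map id) t))
  rw [Measure.map_id]
  simp_rw [fun n => charFun_map_clm (hmeas n) (L n) t]
  obtain ⟨R, hR⟩ := hL t
  have hsq : Tendsto (fun n : ℕ => √(n : ℝ)) atTop atTop :=
    Real.tendsto_sqrt_atTop.comp tendsto_natCast_atTop_atTop
  set C := B + ‖M.meanMap θ₀‖ with hC
  have hC0 : 0 ≤ C := add_nonneg hb.nonneg_bound (norm_nonneg _)
  set E : ℕ → ℂ := fun n => ((Real.exp (-(⟪(L n).adjoint t,
      Matrix.toEuclideanCLM (𝕜 := ℝ) (M.fisher θ₀) ((L n).adjoint t)⟫ +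
        n * σ n ^ 2 * ‖(L n).adjoint t‖ ^ 2) / 2) : ℝ) : ℂ) with hE
  have hdiff : Tendsto (fun n : ℕ => charFun (P.map fun ω =>
      √(n : ℝ) • (M.noisyStat X Z n ω - M.meanMap θ₀)) ((L n).adjoint t) - E n) atTop (𝓝 0) := by
    refine squeeze_zero_norm' (a := fun n : ℕ => 2 * (C * R) ^ 3 / √(n : ℝ)) ?_
      (tendsto_const_nhds.div_atTop hsq)
    filter_upwards [hR, eventually_gt_atTop 0, hsq.eventually_ge_atTop (C * R)] with n hRn hn hn2
    have h1 : C * ‖(L n).adjoint t‖ ≤ C * R := by gcongr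
    refine (hS.norm_charFun_noisyStat_sub_le hb hn (h1.trans hn2)).trans ?_
    gcongr
  have hEt : Tendsto E atTop (𝓝 (charFun (multivariateGaussian 0 V) t)) := by
    have hval : charFun (multivariateGaussian 0 V) t =
        ((Real.exp (-⟪t, Matrix.toEuclideanCLM (𝕜 := ℝ) V t⟫ / 2) : ℝ) : ℂ) := by
      rw [charFun_multivariateGaussian hV, Matrix.inner_toEuclideanCLM, inner_zero_right]
      push_cast
      congr 1
      ring
    rw [hval]
    exact (Complex.continuous_ofReal.tendsto _).comp
      ((Real.continuous_exp.tendsto _).comp ((hlim t).neg.div_const 2))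
  simpa using hdiff.add hEt

/-- The noisy empirical statistic is consistent when the noise scale vanishes. -/
theorem tendsto_measure_le_norm_noisyStat_sub (hb : M.IsBounded B)
    (hS : NoisySample M θ₀ σ P X Z) (hσ : Tendsto σ atTop (𝓝 0)) {r : ℝ} (hr : 0 < r) :
    Tendsto (fun n => P {ω | r ≤ ‖M.noisyStat X Z n ω - M.meanMap θ₀‖}) atTop (𝓝 0) := by
  have hsq : Tendsto (fun n : ℕ => (√(n : ℝ))⁻¹) atTop (𝓝 0) := tendsto_inv_atTop_zero.comp
    (Real.tendsto_sqrt_atTop.comp tendsto_natCast_atTop_atTop)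
  have hadj : ∀ (n : ℕ) (t : EuclideanSpace ℝ (Fin d)),
      ((√(n : ℝ))⁻¹ • ContinuousLinearMap.id ℝ (EuclideanSpace ℝ (Fin d))).adjoint t =
        (√(n : ℝ))⁻¹ • t := fun n t => by
    refine ext_inner_right ℝ fun x => ?_
    rw [ContinuousLinearMap.adjoint_inner_left]
    simp [real_inner_smul_left, real_inner_smul_right]
  -- Undoing the factor `√n` gives the limit covariance 0, that is, convergence in law to a Dirac
  -- mass; the portmanteau theorem turns it into convergence in probability.
  have h := hS.tendstoInDistribution_noisyStat hb
    (fun n => (√(n : ℝ))⁻¹ • ContinuousLinearMap.id ℝ _) (V := 0) Matrix.PosSemidef.zero ?_ ?_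
  · have hdirac : multivariateGaussian 0 (0 : Matrix (Fin d) (Fin d) ℝ) = Measure.dirac 0 := by
      simp [multivariateGaussian]
    have hF : IsClosed {x : EuclideanSpace ℝ (Fin d) | r ≤ ‖x‖} :=
      isClosed_le continuous_const continuous_norm
    have hls := ProbabilityMeasure.limsup_measure_closed_le_of_tendsto h.tendsto hF
    simp only [ProbabilityMeasure.coe_mk, Measure.map_id, hdirac] at hls
    rw [Measure.dirac_apply' _ hF.measurableSet, Set.indicator_of_notMem (by simpa using hr)] at hls
    have h0 := tendsto_of_le_liminf_of_limsup_le (a := 0) bot_le hls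
    refine h0.congr' ?_
    filter_upwards [eventually_gt_atTop 0] with n hn
    have hs : √(n : ℝ) ≠ 0 := (Real.sqrt_pos.2 (by exact_mod_cast hn)).ne'
    rw [Measure.map_apply_of_aemeasurable (h.forall_aemeasurable n) hF.measurableSet]
    simp [smul_smul, mul_inv_cancel₀ hs]
  · intro t
    refine ⟨‖t‖, ?_⟩
    filter_upwards [hsq.eventually_le_const one_pos] with n hn
    rw [hadj, norm_smul, Real.norm_eq_abs, abs_of_nonneg (by positivity)]
    exact mul_le_of_le_one_left (norm_nonneg _) hn
  · intro t
    have h1 : Tendsto (fun n : ℕ => (√(n : ℝ))⁻¹ * ((√(n : ℝ))⁻¹ *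
        ⟪t, Matrix.toEuclideanCLM (𝕜 := ℝ) (M.fisher θ₀) t⟫) + σ n ^ 2 * ‖t‖ ^ 2) atTop (𝓝 0) := by
      simpa using (hsq.mul (hsq.mul_const _)).add ((hσ.pow 2).mul_const (‖t‖ ^ 2))
    simp only [map_zero, zero_apply, inner_zero_right]
    refine h1.congr' ?_
    filter_upwards [eventually_gt_atTop 0] with n hn
    have hn' : (0 : ℝ) < n := by exact_mod_cast hn
    rw [hadj, map_smul, real_inner_smul_left, real_inner_smul_right, norm_smul, mul_pow,
      Real.norm_eq_abs, sq_abs, inv_pow, Real.sq_sqrt hn'.le]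
    field_simp

end NoisySample
end ExpFamily

/-! ### The delta method -/

section DeltaMethod

variable {E F : Type*} [NormedAddCommGroup E] [MeasurableSpace E] [BorelSpace E]
  {Ω : Type*} [MeasurableSpace Ω] {P : Measure Ω}
  [IsProbabilityMeasure P] {ν : Measure E} [IsProbabilityMeasure ν]

/-- A sequence that converges in distribution is asymptotically tight. -/
theorem exists_eventually_measure_le_norm_le {W : ℕ → Ω → E}
    (hW : TendstoInDistribution W atTop id (fun _ => P) ν) {η : ENNReal} (hη : 0 < η) :
    ∃ K : ℝ, 0 < K ∧ ∀ᶠ n in atTop, P {ω | K ≤ ‖W n ω‖} ≤ η := by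
  have hlim : Tendsto (fun k : ℕ => ν {x | (k : ℝ) ≤ ‖x‖}) atTop (𝓝 0) := by
    have h := tendsto_measure_iInter_atTop (μ := ν) (s := fun k : ℕ => {x : E | (k : ℝ) ≤ ‖x‖})
      (fun k => (measurableSet_le measurable_const measurable_norm).nullMeasurableSet)
      (fun i j hij x hx => le_trans (by exact_mod_cast hij : (i : ℝ) ≤ j) hx) ⟨0, by finiteness⟩
    have hempty : ⋂ k : ℕ, {x : E | (k : ℝ) ≤ ‖x‖} = ∅ := by
      refine Set.eq_empty_of_forall_notMem fun x hx => ?_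
      obtain ⟨k, hk⟩ := exists_nat_gt ‖x‖
      exact absurd (Set.mem_iInter.1 hx k) (not_le.2 hk)
    rwa [hempty, measure_empty] at h
  obtain ⟨k, hk, hk0⟩ := ((hlim.eventually_lt_const hη).and (eventually_gt_atTop 0)).exists
  refine ⟨k, by exact_mod_cast hk0, ?_⟩
  have hF : IsClosed {x : E | (k : ℝ) ≤ ‖x‖} := isClosed_le continuous_const continuous_norm
  have hls := ProbabilityMeasure.limsup_measure_closed_le_of_tendsto hW.tendsto hF
  simp only [ProbabilityMeasure.coe_mk, Measure.map_id] at hls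
  filter_upwards [eventually_lt_of_limsup_lt (hls.trans_lt hk)] with n hn
  rw [Measure.map_apply_of_aemeasurable (hW.forall_aemeasurable n) hF.measurableSet] at hn
  exact hn.le

/-- A remainder that is `o(‖W‖)` in probability vanishes because `W` is tight. -/
theorem tendstoInMeasure_zero_of_le_mul_norm {W R : ℕ → Ω → E}
    (hW : TendstoInDistribution W atTop id (fun _ => P) ν)
    (hR : ∀ η : ℝ, 0 < η → Tendsto (fun n => P {ω | η * ‖W n ω‖ < ‖R n ω‖}) atTop (𝓝 0)) :
    TendstoInMeasure P R atTop 0 := by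
  rw [tendstoInMeasure_iff_norm]
  intro r hr
  rw [ENNReal.tendsto_nhds_zero]
  intro η hη
  obtain ⟨K, hK, hWK⟩ := exists_eventually_measure_le_norm_le hW (ENNReal.half_pos hη.ne')
  have h2 := ENNReal.tendsto_nhds_zero.1 (hR (r / K) (by positivity)) _ (ENNReal.half_pos hη.ne')
  filter_upwards [hWK, h2] with n hn1 hn2
  calc P {ω | r ≤ ‖R n ω - (0 : ℕ → Ω → E) n ω‖}
      ≤ P ({ω | r / K * ‖W n ω‖ < ‖R n ω‖} ∪ {ω | K ≤ ‖W n ω‖}) := by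
        refine measure_mono fun ω hω => ?_
        simp only [Pi.zero_apply, sub_zero, Set.mem_ofPred_eq] at hω
        by_contra hcon
        simp only [Set.mem_union, Set.mem_ofPred_eq, not_or, not_lt, not_le] at hcon
        have : r / K * ‖W n ω‖ < r / K * K := by
          exact mul_lt_mul_of_pos_left hcon.2 (by positivity)
        rw [div_mul_cancel₀ _ hK.ne'] at this
        linarith [hcon.1]
    _ ≤ η / 2 + η / 2 := (measure_union_le _ _).trans (add_le_add hn2 hn1)
    _ = η := ENNReal.add_halves η

variable [SecondCountableTopology E]

/-- The delta method with normalizing operators `K n` that may vary with `n`. -/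
theorem tendstoInDistribution_of_hasFDerivAt [NormedSpace ℝ E] [NormedAddCommGroup F]
    [NormedSpace ℝ F] [MeasurableSpace F] [BorelSpace F]
    {f : F → F} {D : F →L[ℝ] F} {a : F} (hf : HasFDerivAt f D a) (K : ℕ → F →L[ℝ] E)
    {Y T : ℕ → Ω → F} (hT : ∀ n, AEMeasurable (T n) P)
    (hY : ∀ r : ℝ, 0 < r → Tendsto (fun n => P {ω | r ≤ ‖Y n ω - a‖}) atTop (𝓝 0))
    (hTY : Tendsto (fun n => P {ω | T n ω ≠ f (Y n ω)}) atTop (𝓝 0))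
    {C : ℝ} (hK : ∀ᶠ n in atTop, ∀ y, ‖K n‖ * ‖y‖ ≤ C * ‖K n (D y)‖)
    (hW : TendstoInDistribution (fun n ω => K n (D (Y n ω - a))) atTop id (fun _ => P) ν) :
    TendstoInDistribution (fun n ω => K n (T n ω - f a)) atTop id (fun _ => P) ν := by
  have hTm : ∀ n, AEMeasurable (fun ω => K n (T n ω - f a)) P := fun n =>
    (K n).continuous.measurable.comp_aemeasurable ((hT n).sub_const (f a))
  -- Slutsky: the remainder is compared with the main term `K n (D (Y - a))` itself. Condition `hK`
  -- bounds the conditioning of `K n ∘ D` and ignores scalar factors, so the rate may be absorbed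
  -- into `K n`.
  refine tendstoInDistribution_of_tendstoInMeasure_sub _ _ hW
    (tendstoInMeasure_zero_of_le_mul_norm hW fun η hη => ?_) hTm
  set c : ℝ := η / (|C| + 1) with hc
  have hcpos : 0 < c := by positivity
  obtain ⟨r, hr, hball⟩ := Metric.eventually_nhds_iff.1 (hf.isLittleO.def hcpos)
  have hsum : Tendsto (fun n => P {ω | r ≤ ‖Y n ω - a‖} + P {ω | T n ω ≠ f (Y n ω)}) atTop
      (𝓝 0) := by
    simpa using (hY r hr).add hTY
  refine tendsto_of_tendsto_of_tendsto_of_le_of_le' tendsto_const_nhds hsum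
    (Eventually.of_forall fun _ => zero_le) ?_
  filter_upwards [hK] with n hKn
  refine (measure_mono fun ω hω => ?_).trans (measure_union_le _ _)
  by_contra hcon
  simp only [Set.mem_union, Set.mem_ofPred_eq, not_or, not_le, not_not] at hcon
  have h1 := hball (y := Y n ω) (by rw [dist_eq_norm]; exact hcon.1)
  have h2 : ((fun n ω => K n (T n ω - f a)) - fun n ω => K n (D (Y n ω - a))) n ω =
      K n (f (Y n ω) - f a - D (Y n ω - a)) := by
    simp only [Pi.sub_apply, hcon.2, ← map_sub]
  rw [Set.mem_ofPred_eq, h2] at hω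
  refine not_lt.2 ?_ hω
  calc ‖K n (f (Y n ω) - f a - D (Y n ω - a))‖ ≤ ‖K n‖ * (c * ‖Y n ω - a‖) :=
        (K n).le_opNorm_of_le h1
    _ = c * (‖K n‖ * ‖Y n ω - a‖) := by ring
    _ ≤ c * (C * ‖K n (D (Y n ω - a))‖) := by exact mul_le_mul_of_nonneg_left (hKn _) hcpos.le
    _ ≤ c * ((|C| + 1) * ‖K n (D (Y n ω - a))‖) := by gcongr; linarith [le_abs_self C]
    _ = η * ‖K n (D (Y n ω - a))‖ := by rw [hc]; field_simp

end DeltaMethod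

/-! ### Positive definite matrices as operators on Euclidean space -/

section PosDef

variable {d : ℕ} {A : Matrix (Fin d) (Fin d) ℝ}

theorem toEuclideanCLM_adjoint (hA : A.IsHermitian) :
    (Matrix.toEuclideanCLM (𝕜 := ℝ) A).adjoint = Matrix.toEuclideanCLM (𝕜 := ℝ) A := by
  rw [← ContinuousLinearMap.star_eq_adjoint, ← map_star, Matrix.star_eq_conjTranspose, hA.eq]

theorem toEuclideanCLM_inner_comm (hA : A.IsHermitian) (x y : EuclideanSpace ℝ (Fin d)) :
    ⟪Matrix.toEuclideanCLM (𝕜 := ℝ) A x, y⟫ = ⟪x, Matrix.toEuclideanCLM (𝕜 := ℝ) A y⟫ := by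
  rw [← ContinuousLinearMap.adjoint_inner_right, toEuclideanCLM_adjoint hA]

theorem toEuclideanCLM_mul_apply (A B : Matrix (Fin d) (Fin d) ℝ) (x : EuclideanSpace ℝ (Fin d)) :
    Matrix.toEuclideanCLM (𝕜 := ℝ) (A * B) x =
      Matrix.toEuclideanCLM (𝕜 := ℝ) A (Matrix.toEuclideanCLM (𝕜 := ℝ) B x) := by
  rw [map_mul]; rfl

theorem toEuclideanCLM_inv_apply (hA : IsUnit A.det) (x : EuclideanSpace ℝ (Fin d)) :
    Matrix.toEuclideanCLM (𝕜 := ℝ) A⁻¹ (Matrix.toEuclideanCLM (𝕜 := ℝ) A x) = x := by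
  rw [← toEuclideanCLM_mul_apply, Matrix.nonsing_inv_mul _ hA, map_one]; rfl

theorem toEuclideanCLM_apply_inv (hA : IsUnit A.det) (x : EuclideanSpace ℝ (Fin d)) :
    Matrix.toEuclideanCLM (𝕜 := ℝ) A (Matrix.toEuclideanCLM (𝕜 := ℝ) A⁻¹ x) = x := by
  rw [← toEuclideanCLM_mul_apply, Matrix.mul_nonsing_inv _ hA, map_one]; rfl

theorem isHermitian_cfcSqrt (A : Matrix (Fin d) (Fin d) ℝ) : (CFC.sqrt A).IsHermitian :=
  (Matrix.nonneg_iff_posSemidef.1 (CFC.sqrt_nonneg A)).isHermitian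

theorem isUnit_det_cfcSqrt (hA : A.PosDef) : IsUnit (CFC.sqrt A).det := by
  have h := CFC.sqrt_mul_sqrt_self A hA.posSemidef.nonneg
  have h2 := congrArg Matrix.det h
  rw [Matrix.det_mul] at h2
  exact isUnit_of_mul_isUnit_left (h2 ▸ hA.det_pos.ne'.isUnit)

theorem norm_cfcSqrt_apply_sq (hA : A.PosSemidef) (x : EuclideanSpace ℝ (Fin d)) :
    ‖Matrix.toEuclideanCLM (𝕜 := ℝ) (CFC.sqrt A) x‖ ^ 2 =
      ⟪x, Matrix.toEuclideanCLM (𝕜 := ℝ) A x⟫ := by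
  rw [← real_inner_self_eq_norm_sq, toEuclideanCLM_inner_comm (isHermitian_cfcSqrt A),
    ← toEuclideanCLM_mul_apply, CFC.sqrt_mul_sqrt_self A hA.nonneg]

/-- The form `⟪x, A x⟫` of a positive definite matrix is bounded below. -/
theorem exists_pos_mul_sq_le_inner (hA : A.PosDef) :
    ∃ a : ℝ, 0 < a ∧ ∀ x : EuclideanSpace ℝ (Fin d),
      a * ‖x‖ ^ 2 ≤ ⟪x, Matrix.toEuclideanCLM (𝕜 := ℝ) A x⟫ := by
  set S := Matrix.toEuclideanCLM (𝕜 := ℝ) (CFC.sqrt A)⁻¹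
  refine ⟨((‖S‖ + 1) ^ 2)⁻¹, by positivity, fun x => ?_⟩
  rw [← norm_cfcSqrt_apply_sq hA.posSemidef, inv_mul_le_iff₀ (by positivity), ← mul_pow]
  gcongr
  calc ‖x‖ = ‖S (Matrix.toEuclideanCLM (𝕜 := ℝ) (CFC.sqrt A) x)‖ := by
        rw [toEuclideanCLM_inv_apply (isUnit_det_cfcSqrt hA)]
    _ ≤ ‖S‖ * ‖Matrix.toEuclideanCLM (𝕜 := ℝ) (CFC.sqrt A) x‖ := S.le_opNorm _
    _ ≤ _ := by gcongr; linarith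

theorem posSemidef_mul_self_of_isHermitian (hA : A.IsHermitian) : (A * A).PosSemidef := by
  have := Matrix.posSemidef_conjTranspose_mul_self A
  rwa [hA.eq] at this

end PosDef

namespace ExpFamily

variable {𝒳 : Type*} [MeasurableSpace 𝒳] {d : ℕ} {M : ExpFamily 𝒳 d} {B : ℝ}
  {θ₀ : EuclideanSpace ℝ (Fin d)}

theorem posDef_inflatedCov (hI : (M.fisher θ₀).PosDef) {v : ℝ} (hv : 0 ≤ v) :
    (M.inflatedCov θ₀ v).PosDef :=
  hI.inv.add_posSemidef ((posSemidef_mul_self_of_isHermitian hI.inv.isHermitian).smul hv)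

theorem inner_inflatedCov (hI : (M.fisher θ₀).PosDef) (v : ℝ) (x : EuclideanSpace ℝ (Fin d)) :
    ⟪x, Matrix.toEuclideanCLM (𝕜 := ℝ) (M.inflatedCov θ₀ v) x⟫ =
      ⟪x, Matrix.toEuclideanCLM (𝕜 := ℝ) (M.fisher θ₀)⁻¹ x⟫ +
        v * ‖Matrix.toEuclideanCLM (𝕜 := ℝ) (M.fisher θ₀)⁻¹ x‖ ^ 2 := by
  rw [inflatedCov, map_add, map_smul, add_apply, smul_apply, inner_add_right,
    real_inner_smul_right, toEuclideanCLM_mul_apply,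
    ← toEuclideanCLM_inner_comm hI.inv.isHermitian x
      (Matrix.toEuclideanCLM (𝕜 := ℝ) (M.fisher θ₀)⁻¹ x),
    real_inner_self_eq_norm_sq]

/-- Two-sided bounds for the predicted covariance, uniform in the noise level. -/
theorem exists_inflatedCov_bounds (hI : (M.fisher θ₀).PosDef) :
    ∃ a b : ℝ, 0 < a ∧ 0 < b ∧ ∀ v : ℝ, 0 ≤ v → ∀ x : EuclideanSpace ℝ (Fin d),
      a * (1 + v) * ‖x‖ ^ 2 ≤ ⟪x, Matrix.toEuclideanCLM (𝕜 := ℝ) (M.inflatedCov θ₀ v) x⟫ ∧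
      ⟪x, Matrix.toEuclideanCLM (𝕜 := ℝ) (M.inflatedCov θ₀ v) x⟫ ≤ b * (1 + v) * ‖x‖ ^ 2 := by
  obtain ⟨a, ha, hlow⟩ := exists_pos_mul_sq_le_inner hI.inv
  set I := Matrix.toEuclideanCLM (𝕜 := ℝ) (M.fisher θ₀)
  set J := Matrix.toEuclideanCLM (𝕜 := ℝ) (M.fisher θ₀)⁻¹ with hJ
  have hdet : IsUnit (M.fisher θ₀).det := hI.det_pos.ne'.isUnit
  -- The same multiple of `‖x‖²` bounds both `⟪x, J x⟫` and `‖J x‖²` below, so the lower bound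
  -- scales like `1 + v`. The terms `+ 1` only ensure positivity.
  refine ⟨min a ((‖I‖ + 1) ^ 2)⁻¹, ‖J‖ + ‖J‖ ^ 2 + 1, by positivity, by positivity,
    fun v hv x => ?_⟩
  rw [inner_inflatedCov hI]
  constructor
  · have h1 : ((‖I‖ + 1) ^ 2)⁻¹ * ‖x‖ ^ 2 ≤ ‖J x‖ ^ 2 := by
      rw [inv_mul_le_iff₀ (by positivity), ← mul_pow]
      gcongr
      calc ‖x‖ = ‖I (J x)‖ := by rw [toEuclideanCLM_apply_inv hdet]
        _ ≤ ‖I‖ * ‖J x‖ := I.le_opNorm _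
        _ ≤ _ := by gcongr; linarith
    have h2 : min a ((‖I‖ + 1) ^ 2)⁻¹ * ‖x‖ ^ 2 ≤ ⟪x, J x⟫ :=
      (mul_le_mul_of_nonneg_right (min_le_left _ _) (by positivity)).trans (hlow x)
    have h3 : min a ((‖I‖ + 1) ^ 2)⁻¹ * ‖x‖ ^ 2 ≤ ‖J x‖ ^ 2 :=
      (mul_le_mul_of_nonneg_right (min_le_right _ _) (by positivity)).trans h1
    linarith [mul_le_mul_of_nonneg_left h3 hv]
  · have h1 : ‖J x‖ ≤ ‖J‖ * ‖x‖ := J.le_opNorm x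
    have h2 : ⟪x, J x⟫ ≤ ‖J‖ * ‖x‖ ^ 2 := by
      calc ⟪x, J x⟫ ≤ ‖x‖ * ‖J x‖ := real_inner_le_norm _ _
        _ ≤ ‖x‖ * (‖J‖ * ‖x‖) := by gcongr
        _ = _ := by ring
    have h3 : v * ‖J x‖ ^ 2 ≤ v * (‖J‖ * ‖x‖) ^ 2 := by gcongr
    have h4 : 0 ≤ v * ‖J‖ * ‖x‖ ^ 2 + ‖J‖ ^ 2 * ‖x‖ ^ 2 + (1 + v) * ‖x‖ ^ 2 := by positivity
    nlinarith

/-- Inverse function theorem; `r` is shrunk so that `ψ` takes values in `Θ`, which is possible since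
`θ₀` is interior. With uniqueness of solutions this identifies the estimators with `ψ` of the
statistic. -/
theorem IsBounded.exists_localInverse (hb : M.IsBounded B) (hI : (M.fisher θ₀).PosDef)
    {Θ : Set (EuclideanSpace ℝ (Fin d))} (hθ₀ : θ₀ ∈ interior Θ) :
    ∃ (ψ : EuclideanSpace ℝ (Fin d) → EuclideanSpace ℝ (Fin d)) (r : ℝ), 0 < r ∧
      ψ (M.meanMap θ₀) = θ₀ ∧
      HasFDerivAt ψ (Matrix.toEuclideanCLM (𝕜 := ℝ) (M.fisher θ₀)⁻¹) (M.meanMap θ₀) ∧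
      ∀ y, ‖y - M.meanMap θ₀‖ < r → ψ y ∈ Θ ∧ M.meanMap (ψ y) = y := by
  have hdet : IsUnit (M.fisher θ₀).det := hI.det_pos.ne'.isUnit
  let e : EuclideanSpace ℝ (Fin d) ≃L[ℝ] EuclideanSpace ℝ (Fin d) :=
    ContinuousLinearEquiv.equivOfInverse (Matrix.toEuclideanCLM (𝕜 := ℝ) (M.fisher θ₀))
      (Matrix.toEuclideanCLM (𝕜 := ℝ) (M.fisher θ₀)⁻¹) (toEuclideanCLM_inv_apply hdet)
      (toEuclideanCLM_apply_inv hdet)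
  have hf : HasStrictFDerivAt M.meanMap (e : EuclideanSpace ℝ (Fin d) →L[ℝ] _) θ₀ :=
    hb.hasStrictFDerivAt_meanMap θ₀
  set ψ := hf.localInverse M.meanMap e θ₀ with hψ
  have hψ0 : ψ (M.meanMap θ₀) = θ₀ := hf.localInverse_apply_image
  have hd : HasFDerivAt ψ (Matrix.toEuclideanCLM (𝕜 := ℝ) (M.fisher θ₀)⁻¹) (M.meanMap θ₀) :=
    hf.to_localInverse.hasFDerivAt
  have hmem : ∀ᶠ y in 𝓝 (M.meanMap θ₀), ψ y ∈ Θ :=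
    hd.continuousAt.eventually_mem (by rw [hψ0]; exact mem_interior_iff_mem_nhds.1 hθ₀)
  obtain ⟨r, hr, hball⟩ := Metric.eventually_nhds_iff.1 (hmem.and hf.eventually_right_inverse)
  exact ⟨ψ, r, hr, hψ0, hd, fun y hy => hball (by rwa [dist_eq_norm])⟩

end ExpFamily

/-! ### Limit laws of the plug-in and maximum likelihood estimators -/

/-- The events that a solution exists need not be measurable, hence subadditivity instead of the
complement rule. -/
theorem tendsto_measure_one_of_compl_subset {Ω ι : Type*} [MeasurableSpace Ω] {P : Measure Ω}
    [IsProbabilityMeasure P] {l : Filter ι} {s t : ι → Set Ω}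
    (ht : Tendsto (fun n => P (t n)) l (𝓝 0)) (hst : ∀ᶠ n in l, (s n)ᶜ ⊆ t n) :
    Tendsto (fun n => P (s n)) l (𝓝 1) := by
  have h : Tendsto (fun n => 1 - P (t n)) l (𝓝 1) := by
    simpa using ENNReal.Tendsto.sub (tendsto_const_nhds (x := (1 : ENNReal))) ht
      (Or.inl ENNReal.one_ne_top)
  refine tendsto_of_tendsto_of_tendsto_of_le_of_le' h tendsto_const_nhds ?_
    (Eventually.of_forall fun _ => prob_le_one)
  filter_upwards [hst] with n hn
  rw [tsub_le_iff_right, ← measure_univ (μ := P)]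
  calc P Set.univ ≤ P (s n ∪ t n) := measure_mono fun ω _ => by
        by_cases hω : ω ∈ s n
        exacts [Or.inl hω, Or.inr (hn hω)]
    _ ≤ _ := measure_union_le _ _

theorem MeasureTheory.TendstoInDistribution.map_limit {ι Ω Ω' E : Type*} [MeasurableSpace Ω]
    [MeasurableSpace Ω'] [TopologicalSpace E] [MeasurableSpace E] [OpensMeasurableSpace E]
    {P : Measure Ω} [IsProbabilityMeasure P] {ν : Measure Ω'} [IsProbabilityMeasure ν]
    {X : ι → Ω → E} {l : Filter ι} {W : Ω' → E} [IsProbabilityMeasure (ν.map W)]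
    (h : TendstoInDistribution X l W (fun _ => P) ν) :
    TendstoInDistribution X l id (fun _ => P) (ν.map W) := by
  refine ⟨h.forall_aemeasurable, aemeasurable_id, ?_⟩
  have h2 := h.tendsto
  simp only [Measure.map_id]
  exact h2

namespace ExpFamily

variable {𝒳 : Type*} [MeasurableSpace 𝒳] {d : ℕ} {M : ExpFamily 𝒳 d} {B : ℝ}
  {Ω : Type*} [MeasurableSpace Ω] {θ₀ : EuclideanSpace ℝ (Fin d)} {σ : ℕ → ℝ} {P : Measure Ω}
  {X : ℕ → Ω → 𝒳} {Z : ℕ → Ω → EuclideanSpace ℝ (Fin d)}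

theorem posSemidef_inflatedCov_sub (hI : (M.fisher θ₀).PosDef) {c v : ℝ} (hcv : c ≤ v) :
    (M.inflatedCov θ₀ v - M.inflatedCov θ₀ c).PosSemidef := by
  have h : M.inflatedCov θ₀ v - M.inflatedCov θ₀ c =
      (v - c) • ((M.fisher θ₀)⁻¹ * (M.fisher θ₀)⁻¹) := by
    rw [inflatedCov, inflatedCov, sub_smul]
    abel
  rw [h]
  exact (posSemidef_mul_self_of_isHermitian hI.inv.isHermitian).smul (sub_nonneg.2 hcv)

namespace NoisySample

/-- The case `σ = 0` lets the MLE share the limit theorem of the plug-in estimator. -/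
theorem of_noiseless (hX : ∀ i, HasLaw (X i) (M.law θ₀) P) (hXind : iIndepFun X P)
    [IsProbabilityMeasure P] : NoisySample M θ₀ 0 P X 0 where
  hasLaw_obs := hX
  indep_obs := hXind
  hasLaw_noise n := by
    have : isoGaussian (0 : EuclideanSpace ℝ (Fin d)) 0 = Measure.dirac 0 := by
      simp [isoGaussian, multivariateGaussian]
    simp only [Pi.zero_apply, this]
    exact hasLaw_dirac_of_ae_eq (ae_of_all _ fun _ => rfl)
  indep_noise n := indepFun_const_left (0 : EuclideanSpace ℝ (Fin d)) _

variable [IsProbabilityMeasure P]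

/-- The delta method for estimators that are, with high probability, a function of the noisy
statistic, with matrix normalizations. -/
theorem tendstoInDistribution_estimator (hb : M.IsBounded B) (hS : NoisySample M θ₀ σ P X Z)
    (hσ : Tendsto σ atTop (𝓝 0)) {ψ : EuclideanSpace ℝ (Fin d) → EuclideanSpace ℝ (Fin d)}
    {D : EuclideanSpace ℝ (Fin d) →L[ℝ] EuclideanSpace ℝ (Fin d)}
    (hψ : HasFDerivAt ψ D (M.meanMap θ₀)) {T : ℕ → Ω → EuclideanSpace ℝ (Fin d)}
    (hT : ∀ n, AEMeasurable (T n) P)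
    (hTψ : Tendsto (fun n => P {ω | T n ω ≠ ψ (M.noisyStat X Z n ω)}) atTop (𝓝 0))
    (A : ℕ → EuclideanSpace ℝ (Fin d) →L[ℝ] EuclideanSpace ℝ (Fin d)) {C : ℝ}
    (hA : ∀ n y, ‖A n‖ * ‖y‖ ≤ C * ‖A n (D y)‖)
    {ν : Measure (EuclideanSpace ℝ (Fin d))} [IsProbabilityMeasure ν]
    (hW : TendstoInDistribution (fun (n : ℕ) ω =>
      (A n ∘L D) (√(n : ℝ) • (M.noisyStat X Z n ω - M.meanMap θ₀))) atTop id (fun _ => P) ν) :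
    TendstoInDistribution (fun (n : ℕ) ω => A n (√(n : ℝ) • (T n ω - ψ (M.meanMap θ₀)))) atTop id
      (fun _ => P) ν := by
  have h := tendstoInDistribution_of_hasFDerivAt hψ (fun n : ℕ => √(n : ℝ) • A n) hT
    (fun r hr => hS.tendsto_measure_le_norm_noisyStat_sub hb hσ hr) hTψ (C := C) (ν := ν) ?_ ?_
  · simpa only [_root_.smul_apply, map_smul] using h
  · refine Eventually.of_forall fun n y => ?_
    rw [_root_.smul_apply, norm_smul, norm_smul, mul_assoc, mul_left_comm C]
    exact mul_le_mul_of_nonneg_left (hA n y) (norm_nonneg _)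
  · simpa only [_root_.smul_apply, map_smul, ContinuousLinearMap.comp_apply] using hW

/-- With asymptotically negligible noise the local inverse of `∇A` at the noisy statistic has the
efficient limit law. -/
theorem tendstoInDistribution_of_tendsto_zero (hb : M.IsBounded B) (hI : (M.fisher θ₀).PosDef)
    (hS : NoisySample M θ₀ σ P X Z) (hσ : Tendsto σ atTop (𝓝 0))
    (hv : Tendsto (fun n : ℕ => n * σ n ^ 2) atTop (𝓝 0))
    {ψ : EuclideanSpace ℝ (Fin d) → EuclideanSpace ℝ (Fin d)}
    (hψ : HasFDerivAt ψ (Matrix.toEuclideanCLM (𝕜 := ℝ) (M.fisher θ₀)⁻¹) (M.meanMap θ₀))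
    (hψ0 : ψ (M.meanMap θ₀) = θ₀) {T : ℕ → Ω → EuclideanSpace ℝ (Fin d)}
    (hT : ∀ n, AEMeasurable (T n) P)
    (hTψ : Tendsto (fun n => P {ω | T n ω ≠ ψ (M.noisyStat X Z n ω)}) atTop (𝓝 0)) :
    TendstoInDistribution (fun (n : ℕ) ω => √(n : ℝ) • (T n ω - θ₀)) atTop id (fun _ => P)
      (multivariateGaussian 0 (M.fisher θ₀)⁻¹) := by
  have hdet : IsUnit (M.fisher θ₀).det := hI.det_pos.ne'.isUnit
  set I := Matrix.toEuclideanCLM (𝕜 := ℝ) (M.fisher θ₀) with hIdef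
  set J := Matrix.toEuclideanCLM (𝕜 := ℝ) (M.fisher θ₀)⁻¹ with hJ
  have hJadj : J.adjoint = J := toEuclideanCLM_adjoint hI.inv.isHermitian
  have h := hS.tendstoInDistribution_estimator hb hσ hψ hT hTψ
    (fun _ => ContinuousLinearMap.id ℝ _)
    (C := ‖ContinuousLinearMap.id ℝ (EuclideanSpace ℝ (Fin d))‖ * ‖I‖)
    (ν := multivariateGaussian 0 (M.fisher θ₀)⁻¹) ?_ ?_
  · simpa only [ContinuousLinearMap.id_apply, hψ0] using h
  · intro _ y
    rw [ContinuousLinearMap.id_apply, mul_assoc]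
    gcongr
    calc ‖y‖ = ‖I (J y)‖ := by rw [hIdef, hJ, toEuclideanCLM_apply_inv hdet]
      _ ≤ _ := I.le_opNorm _
  · simp only [ContinuousLinearMap.id_comp]
    refine hS.tendstoInDistribution_noisyStat hb (fun _ => J) hI.inv.posSemidef
      (fun t => ⟨‖J.adjoint t‖, Eventually.of_forall fun _ => le_rfl⟩) fun t => ?_
    -- The sampling part of the limit covariance is `I⁻¹ I I⁻¹ = I⁻¹`.
    have h1 : I (J t) = t := by rw [hIdef, hJ, toEuclideanCLM_apply_inv hdet]
    rw [hJadj, h1, real_inner_comm]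
    simpa using (hv.mul_const (‖J t‖ ^ 2)).const_add ⟪t, J t⟫

/-- The standardized limit law under the predicted covariance. -/
theorem tendstoInDistribution_standardized (hb : M.IsBounded B) (hI : (M.fisher θ₀).PosDef)
    (hS : NoisySample M θ₀ σ P X Z) (hσ : Tendsto σ atTop (𝓝 0))
    {ψ : EuclideanSpace ℝ (Fin d) → EuclideanSpace ℝ (Fin d)}
    (hψ : HasFDerivAt ψ (Matrix.toEuclideanCLM (𝕜 := ℝ) (M.fisher θ₀)⁻¹) (M.meanMap θ₀))
    (hψ0 : ψ (M.meanMap θ₀) = θ₀) {T : ℕ → Ω → EuclideanSpace ℝ (Fin d)}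
    (hT : ∀ n, AEMeasurable (T n) P)
    (hTψ : Tendsto (fun n => P {ω | T n ω ≠ ψ (M.noisyStat X Z n ω)}) atTop (𝓝 0)) :
    TendstoInDistribution (fun (n : ℕ) ω =>
      Matrix.toEuclideanCLM (𝕜 := ℝ) (CFC.sqrt (M.inflatedCov θ₀ (n * σ n ^ 2)))⁻¹
        (√(n : ℝ) • (T n ω - θ₀))) atTop id (fun _ => P)
      (multivariateGaussian 0 (1 : Matrix (Fin d) (Fin d) ℝ)) := by
  have hdet : IsUnit (M.fisher θ₀).det := hI.det_pos.ne'.isUnit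
  obtain ⟨a, b, ha, hb0, hab⟩ := exists_inflatedCov_bounds hI
  set I := Matrix.toEuclideanCLM (𝕜 := ℝ) (M.fisher θ₀) with hIdef
  set J := Matrix.toEuclideanCLM (𝕜 := ℝ) (M.fisher θ₀)⁻¹ with hJ
  have hJadj : J.adjoint = J := toEuclideanCLM_adjoint hI.inv.isHermitian
  have hIJ : ∀ x, I (J x) = x := toEuclideanCLM_apply_inv hdet
  set v : ℕ → ℝ := fun n => n * σ n ^ 2 with hv
  have hv0 : ∀ n, 0 ≤ v n := fun n => by positivity
  set V : ℕ → Matrix (Fin d) (Fin d) ℝ := fun n => M.inflatedCov θ₀ (v n) with hVdef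
  have hV : ∀ n, (V n).PosDef := fun n => posDef_inflatedCov hI (hv0 n)
  set R := fun n => Matrix.toEuclideanCLM (𝕜 := ℝ) (CFC.sqrt (V n)) with hR
  set A := fun n => Matrix.toEuclideanCLM (𝕜 := ℝ) (CFC.sqrt (V n))⁻¹ with hA
  have hRA : ∀ n x, R n (A n x) = x := fun n => toEuclideanCLM_apply_inv (isUnit_det_cfcSqrt (hV n))
  have hAadj : ∀ n, (A n).adjoint = A n :=
    fun n => toEuclideanCLM_adjoint (isHermitian_cfcSqrt _).inv
  have hRsq : ∀ n x, ‖R n x‖ ^ 2 = ⟪x, Matrix.toEuclideanCLM (𝕜 := ℝ) (V n) x⟫ :=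
    fun n => norm_cfcSqrt_apply_sq (hV n).posSemidef
  have hRle : ∀ n x, ‖R n x‖ ≤ √(b * (1 + v n)) * ‖x‖ := fun n x => by
    have := hv0 n
    rw [← sq_le_sq₀ (norm_nonneg _) (by positivity), mul_pow, Real.sq_sqrt (by positivity), hRsq]
    exact (hab (v n) (hv0 n) x).2
  have hAle : ∀ n x, √(a * (1 + v n)) * ‖A n x‖ ≤ ‖x‖ := fun n x => by
    have := hv0 n
    rw [← sq_le_sq₀ (by positivity) (norm_nonneg _), mul_pow, Real.sq_sqrt (by positivity)]
    nth_rewrite 2 [← hRA n x]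
    rw [hRsq]
    exact (hab (v n) (hv0 n) (A n x)).1
  have h := hS.tendstoInDistribution_estimator hb hσ hψ hT hTψ A (C := ‖I‖ * (√b / √a))
    (ν := multivariateGaussian 0 (1 : Matrix (Fin d) (Fin d) ℝ)) ?_ ?_
  · rwa [hψ0] at h
  · intro n y
    have hpos : 0 < 1 + v n := by linarith [hv0 n]
    have h1 : ‖A n‖ ≤ (√(a * (1 + v n)))⁻¹ :=
      (A n).opNorm_le_bound (by positivity) fun x => by
        rw [le_inv_mul_iff₀ (by positivity)]
        exact hAle n x
    have h2 : ‖y‖ ≤ ‖I‖ * (√(b * (1 + v n)) * ‖A n (J y)‖) := by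
      calc ‖y‖ = ‖I (J y)‖ := by rw [hIJ]
        _ ≤ ‖I‖ * ‖J y‖ := I.le_opNorm _
        _ ≤ _ := by
          gcongr
          nth_rewrite 1 [← hRA n (J y)]
          exact hRle n _
    -- The factors `1 + v n` cancel, so the constant does not depend on `n`.
    calc ‖A n‖ * ‖y‖ ≤ (√(a * (1 + v n)))⁻¹ * (‖I‖ * (√(b * (1 + v n)) * ‖A n (J y)‖)) := by
          gcongr
      _ = ‖I‖ * (√b / √a) * ‖A n (J y)‖ := by
          rw [Real.sqrt_mul ha.le, Real.sqrt_mul hb0.le]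
          have : √a ≠ 0 := (Real.sqrt_pos.2 ha).ne'
          have : √(1 + v n) ≠ 0 := (Real.sqrt_pos.2 hpos).ne'
          field_simp
  · have hadj : ∀ n t, (A n ∘L J).adjoint t = J (A n t) := fun n t => by
      rw [ContinuousLinearMap.adjoint_comp, hAadj, hJadj]; rfl
    refine hS.tendstoInDistribution_noisyStat hb (fun n => A n ∘L J) Matrix.PosSemidef.one
      (fun t => ⟨‖J‖ * (‖t‖ / √a), Eventually.of_forall fun n => ?_⟩) fun t => ?_
    · rw [hadj]
      refine (J.le_opNorm _).trans ?_
      gcongr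
      rw [le_div_iff₀ (by positivity), mul_comm]
      refine le_trans ?_ (hAle n t)
      gcongr
      nlinarith [hv0 n]
    -- The exponent does not depend on `n`: it equals `⟪A t, V A t⟫ = ‖R (A t)‖² = ‖t‖²`.
    · refine tendsto_const_nhds.congr fun n => ?_
      have h1 : ⟪A n t, Matrix.toEuclideanCLM (𝕜 := ℝ) (V n) (A n t)⟫ =
          ⟪A n t, J (A n t)⟫ + n * σ n ^ 2 * ‖J (A n t)‖ ^ 2 :=
        inner_inflatedCov hI (v n) (A n t)
      rw [hadj, hIJ, real_inner_comm (A n t), map_one, one_apply_eq_self, ← h1, ← hRsq n (A n t),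
        hRA, real_inner_self_eq_norm_sq]

/-- No sequence of solutions of the plug-in equation is efficient along a subsequence if the noise
variance does not vanish relative to the sampling variance. -/
theorem not_asymptoticallyEfficient_plugIn (hd : 0 < d) (hb : M.IsBounded B)
    (hI : (M.fisher θ₀).PosDef) (hS : NoisySample M θ₀ σ P X Z) {c : ℝ} (hc : 0 < c)
    (hv : ∀ᶠ n : ℕ in atTop, c ≤ n * σ n ^ 2) {Θ : Set (EuclideanSpace ℝ (Fin d))}
    {T : ℕ → Ω → EuclideanSpace ℝ (Fin d)}
    (hTsol : ∀ n ω, (M.plugInSet Θ (M.noisyStat X Z n ω)).Nonempty →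
      T n ω ∈ M.plugInSet Θ (M.noisyStat X Z n ω)) {φ : ℕ → ℕ} (hφ : StrictMono φ) :
    ¬ M.AsymptoticallyEfficient θ₀ P (fun n ω => M.plugInSet Θ (M.noisyStat X Z n ω)) T
      (map φ atTop) := by
  rintro ⟨hne, hlim⟩
  rw [tendsto_map'_iff] at hne
  have hdet : IsUnit (M.fisher θ₀).det := hI.det_pos.ne'.isUnit
  set I := Matrix.toEuclideanCLM (𝕜 := ℝ) (M.fisher θ₀) with hIdef
  set J := Matrix.toEuclideanCLM (𝕜 := ℝ) (M.fisher θ₀)⁻¹ with hJ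
  have hJI : ∀ x, J (I x) = x := toEuclideanCLM_inv_apply hdet
  set ν := multivariateGaussian 0 (M.fisher θ₀)⁻¹ with hν
  have hU : TendstoInDistribution (fun (k : ℕ) ω => √(φ k : ℝ) • (T (φ k) ω - θ₀)) atTop id
      (fun _ => P) ν :=
    ⟨fun k => hlim.forall_aemeasurable (φ k), aemeasurable_id, hlim.tendsto.comp tendsto_map⟩
  have hφt : Tendsto (fun k => √(φ k : ℝ)) atTop atTop :=
    Real.tendsto_sqrt_atTop.comp (tendsto_natCast_atTop_atTop.comp hφ.tendsto_atTop)
  have hY : ∀ r : ℝ, 0 < r →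
      Tendsto (fun k => P {ω | r ≤ ‖T (φ k) ω - θ₀‖}) atTop (𝓝 0) := by
    intro r hr
    rw [ENNReal.tendsto_nhds_zero]
    intro η hη
    obtain ⟨K, -, hK⟩ := exists_eventually_measure_le_norm_le hU hη
    filter_upwards [hK, hφt.eventually_ge_atTop (K / r)] with k hk hk2
    refine (measure_mono fun ω hω => ?_).trans hk
    rw [Set.mem_ofPred_eq] at hω ⊢
    rw [norm_smul, Real.norm_eq_abs, abs_of_nonneg (Real.sqrt_nonneg _)]
    rw [div_le_iff₀ hr] at hk2
    exact hk2.trans (by gcongr)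
  have hmean : Continuous M.meanMap := continuous_iff_continuousAt.2 fun θ =>
    (hb.hasStrictFDerivAt_meanMap θ).hasFDerivAt.continuousAt
  -- Measurability of `T` is recovered from that of `√n (T - θ₀)`, which is part of convergence in
  -- distribution, once `√n ≠ 0`.
  have hTm : ∀ᶠ k in atTop, AEMeasurable (T (φ k)) P := by
    filter_upwards [hφt.eventually_gt_atTop 0] with k hk
    have h := ((hU.forall_aemeasurable k).const_smul (√(φ k : ℝ))⁻¹).add_const θ₀
    simpa [smul_smul, inv_mul_cancel₀ hk.ne'] using h
  have hTY : Tendsto (fun k => P {ω | M.noisyStat X Z (φ k) ω ≠ M.meanMap (T (φ k) ω)}) atTop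
      (𝓝 0) := by
    have h1 : Tendsto (fun k => 1 - P {ω | (M.plugInSet Θ (M.noisyStat X Z (φ k) ω)).Nonempty})
        atTop (𝓝 0) := by
      simpa using ENNReal.Tendsto.sub (tendsto_const_nhds (x := (1 : ENNReal))) hne
        (Or.inl ENNReal.one_ne_top)
    refine tendsto_of_tendsto_of_tendsto_of_le_of_le' tendsto_const_nhds h1
      (Eventually.of_forall fun _ => zero_le) ?_
    filter_upwards [hTm] with k hk
    have hnull : NullMeasurableSet {ω | M.noisyStat X Z (φ k) ω = M.meanMap (T (φ k) ω)} P :=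
      nullMeasurableSet_eq_fun (hS.aemeasurable_noisyStat _)
        (hmean.measurable.comp_aemeasurable hk)
    calc P {ω | M.noisyStat X Z (φ k) ω ≠ M.meanMap (T (φ k) ω)}
        = 1 - P {ω | M.noisyStat X Z (φ k) ω = M.meanMap (T (φ k) ω)} :=
          prob_compl_eq_one_sub₀ hnull
      _ ≤ _ := tsub_le_tsub_left (measure_mono fun ω hω => (hTsol _ ω hω).2.symm) _
  have hνI : IsProbabilityMeasure (ν.map (I ∘ id)) :=
    Measure.isProbabilityMeasure_map I.continuous.measurable.aemeasurable
  -- The delta method with roles exchanged: the noisy statistic is, with high probability, the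
  -- smooth function `∇A` of the consistent estimator.
  have hlimS := tendstoInDistribution_of_hasFDerivAt
    (hb.hasStrictFDerivAt_meanMap θ₀).hasFDerivAt
    (fun k => √(φ k : ℝ) • ContinuousLinearMap.id ℝ (EuclideanSpace ℝ (Fin d)))
    (Y := fun k => T (φ k)) (T := fun k => M.noisyStat X Z (φ k))
    (C := ‖ContinuousLinearMap.id ℝ (EuclideanSpace ℝ (Fin d))‖ * ‖J‖)
    (fun k => hS.aemeasurable_noisyStat _) hY hTY (ν := ν.map (I ∘ id)) ?_ ?_
  · have : Nonempty (Fin d) := ⟨⟨0, hd⟩⟩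
    obtain ⟨t, ht⟩ := exists_ne (0 : EuclideanSpace ℝ (Fin d))
    have htpos : 0 < ‖t‖ := norm_pos_iff.2 ht
    have hchar := ProbabilityMeasure.tendsto_iff_tendsto_charFun.1 hlimS.tendsto t
    -- The image of `N(0, I⁻¹)` under `I` is `N(0, I)`.
    have hval : charFun ((ν.map (I ∘ id)).map id) t = ((Real.exp (-⟪t, I t⟫ / 2) : ℝ) : ℂ) := by
      have h1 : charFun (ν.map fun x => I (id x)) t = charFun (ν.map id) (I.adjoint t) :=
        charFun_map_clm aemeasurable_id I t
      rw [Measure.map_id] at h1 ⊢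
      refine h1.trans ?_
      rw [hIdef, toEuclideanCLM_adjoint hI.isHermitian, ← hIdef,
        hν, charFun_multivariateGaussian hI.inv.posSemidef, ← Matrix.inner_toEuclideanCLM, ← hJ,
        hJI, inner_zero_right, real_inner_comm]
      push_cast
      congr 1
      ring
    simp only [ProbabilityMeasure.coe_mk, hval] at hchar
    set q := ⟪t, I t⟫
    set C := B + ‖M.meanMap θ₀‖
    -- The limit of the moduli is `e^(-q/2)`, but noise variance at least `c` damps every modulus by
    -- `e^(-c‖t‖²/2)`, up to `O(n^(-1/2))`. This is absurd for `t ≠ 0`.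
    have hle : Real.exp (-q / 2) ≤ Real.exp (-(q + c * ‖t‖ ^ 2) / 2) := by
      have h1 : Tendsto (fun k => Real.exp (-(q + c * ‖t‖ ^ 2) / 2) +
          2 * (C * ‖t‖) ^ 3 / √(φ k : ℝ)) atTop (𝓝 (Real.exp (-(q + c * ‖t‖ ^ 2) / 2))) := by
        simpa only [add_zero] using (tendsto_const_nhds (x := Real.exp (-(q + c * ‖t‖ ^ 2) / 2))).add
          ((tendsto_const_nhds (x := 2 * (C * ‖t‖) ^ 3)).div_atTop hφt)
      have h2 := hchar.norm
      rw [Complex.norm_real, Real.norm_eq_abs, abs_of_pos (Real.exp_pos _)] at h2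
      refine le_of_tendsto_of_tendsto h2 h1 ?_
      filter_upwards [hφ.tendsto_atTop.eventually hv, hφ.tendsto_atTop.eventually_gt_atTop 0,
        hφt.eventually_ge_atTop (C * ‖t‖)] with k hk hk0 hk2
      have h3 := hS.norm_charFun_noisyStat_sub_le hb hk0 hk2
      have h4 := (norm_le_norm_add_norm_sub' _ _).trans (add_le_add_right h3 _)
      rw [Complex.norm_real, Real.norm_eq_abs, abs_of_pos (Real.exp_pos _)] at h4
      refine h4.trans ?_
      gcongr
    rw [Real.exp_le_exp] at hle
    have : 0 < c * ‖t‖ ^ 2 := by positivity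
    linarith
  · refine Eventually.of_forall fun k y => ?_
    rw [_root_.smul_apply, norm_smul, norm_smul, ContinuousLinearMap.id_apply, mul_assoc,
      mul_left_comm _ ‖√(φ k : ℝ)‖, mul_assoc]
    gcongr
    calc ‖y‖ = ‖J (I y)‖ := by rw [hJI]
      _ ≤ _ := J.le_opNorm _
  · have h := (hU.continuous_comp I.continuous).map_limit
    refine h.congr (fun k => ae_of_all _ fun ω => ?_) ae_eq_rfl
    simp [hIdef]

end NoisySample
end ExpFamily

end

/-! ### Efficiency and variance inflation of the plug-in DP MLE -/

theorem corollary3 {𝒳 : Type*} [MeasurableSpace 𝒳] {d : ℕ} (hd : 0 < d)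
    -- the model: bounded sufficient statistic, minimal regular family, regular true parameter
    (M : ExpFamily 𝒳 d) (B : ℝ) (hB : 0 < B) (hs : ∀ x, ‖M.s x‖ ≤ B)
    (hM : M.IsMinimalRegular)
    (Θ : Set (EuclideanSpace ℝ (Fin d))) (hΘ : Θ ⊆ M.naturalSpace)
    (θ₀ : EuclideanSpace ℝ (Fin d)) (hθ₀ : θ₀ ∈ interior Θ) (hI : (M.fisher θ₀).PosDef)
    -- privacy levels and calibrated noise scales
    (ε δ σ : ℕ → ℝ) (hε : ∀ᶠ n in atTop, 0 < ε n) (hδ : ∀ᶠ n in atTop, 0 < δ n ∧ δ n < 1)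
    (hσ : ∀ n, σ n = agm d (2 * B / n) (ε n) (δ n))
    -- i.i.d. data and independent Gaussian noise
    {Ω : Type*} [MeasurableSpace Ω] (P : Measure Ω) [IsProbabilityMeasure P]
    (X : ℕ → Ω → 𝒳) (hX : ∀ i, HasLaw (X i) (M.law θ₀) P) (hXind : iIndepFun X P)
    (Z : ℕ → Ω → EuclideanSpace ℝ (Fin d)) (hZ : ∀ n, HasLaw (Z n) (isoGaussian 0 (σ n)) P)
    (hZX : ∀ n, IndepFun (Z n) (fun ω (i : Fin n) => X i ω) P)
    -- the non-private MLE (arbitrary where no maximizer of the likelihood exists)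
    (θhat : ℕ → Ω → EuclideanSpace ℝ (Fin d)) (hθhat_meas : ∀ n, AEMeasurable (θhat n) P)
    (hθhat : ∀ n ω, (M.mleSet Θ fun i : Fin n => X i ω).Nonempty →
      θhat n ω ∈ M.mleSet Θ fun i : Fin n => X i ω)
    -- the plug-in DP MLE (arbitrary where the estimating equation has no solution)
    (θplug : ℕ → Ω → EuclideanSpace ℝ (Fin d)) (hθplug_meas : ∀ n, AEMeasurable (θplug n) P)
    (hθplug : ∀ n ω, (M.plugInSet Θ (M.empStat (fun i : Fin n => X i ω) + Z n ω)).Nonempty →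
      θplug n ω ∈ M.plugInSet Θ (M.empStat (fun i : Fin n => X i ω) + Z n ω)) :
    -- `n ε² → ∞` up to `log (1/δ)`: no asymptotic cost of privacy
    (Tendsto (fun n : ℕ => n * ε n ^ 2 / Real.log (1 / δ n)) atTop atTop →
      Tendsto (fun n : ℕ => (n * σ n ^ 2) • ((M.fisher θ₀)⁻¹ * (M.fisher θ₀)⁻¹)) atTop (𝓝 0) ∧
      M.AsymptoticallyEfficient θ₀ P (fun n ω => M.mleSet Θ fun i : Fin n => X i ω) θhat atTop ∧
      M.AsymptoticallyEfficient θ₀ P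
        (fun n ω => M.plugInSet Θ (M.empStat (fun i : Fin n => X i ω) + Z n ω)) θplug atTop) ∧
    -- `n ε²` bounded (and `δ = O(n ^ (-1/2))`): non-negligible variance inflation
    ((∃ C : ℝ, ∀ᶠ n : ℕ in atTop, n * ε n ^ 2 ≤ C) →
      (∃ C : ℝ, ∀ᶠ n : ℕ in atTop, √(n : ℝ) * δ n ≤ C) →
      (∃ c : ℝ, 0 < c ∧ ∀ᶠ n : ℕ in atTop,
        (M.inflatedCov θ₀ (n * σ n ^ 2) - M.inflatedCov θ₀ c).PosSemidef) ∧
      (Tendsto σ atTop (𝓝 0) →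
        Tendsto (fun n => P {ω | (M.plugInSet Θ
          (M.empStat (fun i : Fin n => X i ω) + Z n ω)).Nonempty}) atTop (𝓝 1) ∧
        TendstoInDistribution (fun (n : ℕ) ω =>
          Matrix.toEuclideanCLM (𝕜 := ℝ) (CFC.sqrt (M.inflatedCov θ₀ (n * σ n ^ 2)))⁻¹
            (√(n : ℝ) • (θplug n ω - θ₀))) atTop id (fun _ => P)
          (multivariateGaussian 0 (1 : Matrix (Fin d) (Fin d) ℝ))) ∧
      ∀ φ : ℕ → ℕ, StrictMono φ →
        ¬ M.AsymptoticallyEfficient θ₀ P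
          (fun n ω => M.plugInSet Θ (M.empStat (fun i : Fin n => X i ω) + Z n ω)) θplug
          (map φ atTop)) := by
  have hθ₀' : θ₀ ∈ M.naturalSpace := hΘ (interior_subset hθ₀)
  have hb : M.IsBounded B := M.isBounded_of_mem_naturalSpace hd hs hM hθ₀'
  have hS : M.NoisySample θ₀ σ P X Z := ⟨hX, hXind, hZ, hZX⟩
  have hS0 : M.NoisySample θ₀ 0 P X 0 := ExpFamily.NoisySample.of_noiseless hX hXind
  obtain ⟨ψ, r, hr, hψ0, hψ, hψr⟩ := hb.exists_localInverse hI hθ₀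
  have hplug : ∀ n ω, ‖M.noisyStat X Z n ω - M.meanMap θ₀‖ < r →
      M.plugInSet Θ (M.noisyStat X Z n ω) = {ψ (M.noisyStat X Z n ω)} := by
    intro n ω h
    obtain ⟨h1, h2⟩ := hψr _ h
    have h3 := hb.plugInSet_eq_singleton hM h1
    rwa [h2] at h3
  have hplug_sub : ∀ n, {ω | θplug n ω ≠ ψ (M.noisyStat X Z n ω)} ⊆
      {ω | r ≤ ‖M.noisyStat X Z n ω - M.meanMap θ₀‖} := by
    intro n ω hω
    by_contra h
    have h1 := hplug n ω (not_le.1 h)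
    have h2 : θplug n ω ∈ M.plugInSet Θ (M.noisyStat X Z n ω) :=
      hθplug n ω (h1 ▸ Set.singleton_nonempty _)
    rw [h1] at h2
    exact hω h2
  have hplug_ne : ∀ n, {ω | (M.plugInSet Θ (M.noisyStat X Z n ω)).Nonempty}ᶜ ⊆
      {ω | r ≤ ‖M.noisyStat X Z n ω - M.meanMap θ₀‖} := by
    intro n ω hω
    by_contra h
    refine hω ?_
    rw [Set.mem_ofPred_eq, hplug n ω (not_le.1 h)]
    exact Set.singleton_nonempty _
  have hplug_tendsto : Tendsto σ atTop (𝓝 0) →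
      Tendsto (fun n => P {ω | (M.plugInSet Θ (M.noisyStat X Z n ω)).Nonempty}) atTop (𝓝 1) ∧
      Tendsto (fun n => P {ω | θplug n ω ≠ ψ (M.noisyStat X Z n ω)}) atTop (𝓝 0) := by
    intro h
    have hcons := hS.tendsto_measure_le_norm_noisyStat_sub hb h hr
    exact ⟨tendsto_measure_one_of_compl_subset hcons (Eventually.of_forall hplug_ne),
      tendsto_of_tendsto_of_tendsto_of_le_of_le tendsto_const_nhds hcons (fun _ => zero_le)
        fun n => measure_mono (hplug_sub n)⟩
  refine ⟨fun h => ?_, fun h1 h2 => ?_⟩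
  · have hv : Tendsto (fun n : ℕ => n * σ n ^ 2) atTop (𝓝 0) := by
      simp_rw [hσ]
      exact tendsto_mul_sq_agm_zero hB hε hδ h
    -- For `n ≥ 1`, `σ² ≤ n σ²`.
    have hσ0 : Tendsto σ atTop (𝓝 0) := by
      have hsq : Tendsto (fun n => σ n ^ 2) atTop (𝓝 0) := by
        refine tendsto_of_tendsto_of_tendsto_of_le_of_le' tendsto_const_nhds hv
          (Eventually.of_forall fun n => sq_nonneg _) ?_
        filter_upwards [eventually_ge_atTop 1] with n hn
        exact le_mul_of_one_le_left (sq_nonneg _) (by exact_mod_cast hn)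
      have hnorm : Tendsto (fun n => |σ n|) atTop (𝓝 0) := by
        simpa [Real.sqrt_sq_eq_abs] using hsq.sqrt
      exact (tendsto_zero_iff_abs_tendsto_zero σ).2 hnorm
    obtain ⟨hne, hag⟩ := hplug_tendsto hσ0
    refine ⟨?_, ?_, hne, hS.tendstoInDistribution_of_tendsto_zero hb hI hσ0 hv hψ hψ0 hθplug_meas
      hag⟩
    · simpa using hv.smul_const ((M.fisher θ₀)⁻¹ * (M.fisher θ₀)⁻¹)
    · have hzero : Tendsto (0 : ℕ → ℝ) atTop (𝓝 0) := tendsto_const_nhds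
      have hstat : ∀ n ω, M.noisyStat X 0 n ω = M.empStat (fun i : Fin n => X i ω) := fun n ω => by
        simp [ExpFamily.noisyStat]
      have hcons := hS0.tendsto_measure_le_norm_noisyStat_sub hb hzero hr
      have hpos : P {ω | ∃ i, ¬ 0 < M.h (X i ω)} = 0 := by
        have h1 : ∀ᵐ ω ∂P, ∀ i, 0 < M.h (X i ω) := ae_all_iff.2 fun i =>
          ((hX i).ae_iff (measurable_const.lt M.measurable_h)).2
            (ExpFamily.IsBounded.ae_law_h_pos θ₀)
        simpa [ae_iff] using h1
      have hbad : Tendsto (fun n => P ({ω | r ≤ ‖M.noisyStat X 0 n ω - M.meanMap θ₀‖} ∪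
          {ω | ∃ i, ¬ 0 < M.h (X i ω)})) atTop (𝓝 0) := by
        refine tendsto_of_tendsto_of_tendsto_of_le_of_le tendsto_const_nhds hcons
          (fun _ => zero_le) fun n => ?_
        refine (measure_union_le _ _).trans ?_
        rw [hpos, add_zero]
      -- The case `n = 0` is excluded: the empty likelihood is constant and every point of `Θ`
      -- maximizes it.
      have hmle : ∀ n : ℕ, 0 < n → ∀ ω, ω ∉ {ω | r ≤ ‖M.noisyStat X 0 n ω - M.meanMap θ₀‖} ∪
          {ω | ∃ i, ¬ 0 < M.h (X i ω)} →
          (M.mleSet Θ fun i : Fin n => X i ω) = {ψ (M.noisyStat X 0 n ω)} := by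
        intro n hn ω hω
        rw [Set.mem_union, not_or] at hω
        obtain ⟨h1, h2⟩ := hψr _ (not_le.1 hω.1)
        have h3 : ∀ i, 0 < M.h (X i ω) := by simpa using hω.2
        exact hb.mleSet_eq_singleton hM hn (fun i => h3 i) h1 (h2.trans (hstat n ω))
      refine ⟨tendsto_measure_one_of_compl_subset hbad ?_,
        hS0.tendstoInDistribution_of_tendsto_zero hb hI hzero (by simp) hψ hψ0 hθhat_meas ?_⟩
      · filter_upwards [eventually_gt_atTop 0] with n hn ω hω
        by_contra hc
        refine hω ?_
        rw [Set.mem_ofPred_eq, hmle n hn ω hc]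
        exact Set.singleton_nonempty _
      · refine tendsto_of_tendsto_of_tendsto_of_le_of_le' tendsto_const_nhds hbad
          (Eventually.of_forall fun _ => zero_le) ?_
        filter_upwards [eventually_gt_atTop 0] with n hn
        refine measure_mono fun ω hω => ?_
        by_contra hc
        have h1 := hmle n hn ω hc
        have h2 := hθhat n ω (h1 ▸ Set.singleton_nonempty _)
        rw [h1] at h2
        exact hω h2
  · obtain ⟨c, hc, hcv⟩ := eventually_le_mul_sq_agm hd hB hε hδ h1 h2
    simp_rw [← hσ] at hcv
    refine ⟨⟨c, hc, hcv.mono fun n hn => ExpFamily.posSemidef_inflatedCov_sub hI hn⟩,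
      fun hσ0 => ?_, fun φ hφ => hS.not_asymptoticallyEfficient_plugIn hd hb hI hc hcv hθplug hφ⟩
    obtain ⟨hne, hag⟩ := hplug_tendsto hσ0
    exact ⟨hne, hS.tendstoInDistribution_standardized hb hI hσ0 hψ hψ0 hθplug_meas hag⟩
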